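/- **Setting.** There are a high-tier stochastic bandit $M_{\rm Hi}$ and $W$ source bandits $M_{{\rm Lo},1},\dots,M_{{\rm Lo},W}$ with the same arms $[A]=\{1,\dots,A\}$. All rewards lie in $[0,1]$ and have means $\mu_{\rm Hi}(i)$, $\mu_{{\rm Lo},w}(i)$; rewards are independent over iterations, tasks and arms. Every task has a unique optimal arm, $i^*_{\rm Hi}$ and $i^*_{{\rm Lo},w}$ respectively. Let $\Delta_{\min}>0$ be the smallest gap $\max_j\mu(j)-\mu(i)$ of a non-optimal arm $i$, over all source tasks and $M_{\rm Hi}$. Assume $\mu_{{\rm Lo},w}(i^*_{{\rm Lo},w})\ge \mu_{\rm Hi}(i^*_{\rm Hi})-\Delta_{\min}/2$ for every $w\in[W]$, and let $0\le\tilde\Delta_{\min}\le\Delta_{\min}$. $M_{\rm Hi}$ and $M_{{\rm Lo},w}$ are called $\epsilon$-close if $\mu_{{\rm Lo},w}(i^*_{{\rm Lo},w})-\mu_{\rm Hi}(i^*_{\rm Hi})\le\epsilon$ and $i^*_{{\rm Lo},w}=i^*_{\rm Hi}$. **Algorithm** (parameters $\alpha>2$ and $\epsilon$). Put $f(k)=1+16WA^2(k+1)^2$.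 In iterations $k=1,\dots,A$ pull arm $k$ in every task; set $w^A=\mathrm{Null}$. For $k>A$ let $N^k_{{\rm Lo},w}(i)$, $N^k_{\rm Hi}(i)$ and $\hat\mu^k_{{\rm Lo},w}(i)$, $\hat\mu^k_{\rm Hi}(i)$ be the numbers of pulls and the empirical means before iteration $k$, and let $\overline\mu^k$, $\underline\mu^k$ be $\hat\mu^k\pm\sqrt{2\alpha\log f(k)/N^k}$. Let $\overline\pi^k_{{\rm Lo},w}$, $\overline\pi^k_{\rm Hi}$ be maximizers of $\overline\mu^k_{{\rm Lo},w}$, $\overline\mu^k_{\rm Hi}$, and $\underline\pi^k_{{\rm Lo},w}$ a maximizer of $\underline\mu^k_{{\rm Lo},w}$ (ties are broken by an arbitrary measurable rule, which may depend on $k$ and the task). Let $$\mathcal I^k=\Big\{w\in[W]:\ \underline\mu^k_{{\rm Lo},w}(\underline\pi^k_{{\rm Lo},w})\le\overline\mu^k_{\rm Hi}(\underline\pi^k_{{\rm Lo},w})+\epsilon,\ \ N^k_{{\rm Lo},w}(\underline\pi^k_{{\rm Lo},w})>k/2\Big\}.$$ If $\mathcal I^k=\emptyset$, set $w^k=\mathrm{Null}$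 and $\pi^k_{\rm Hi}=\overline\pi^k_{\rm Hi}$. Otherwise choose $w^k$ as follows and set $\pi^k_{\rm Hi}=\underline\pi^k_{{\rm Lo},w^k}$: if $w^{k-1}\in\mathcal I^k$, then $w^k=w^{k-1}$; else, if $w^{k-1}\ne\mathrm{Null}$ and some $w\in\mathcal I^k$ has $\pi^{k-1}_{\rm Hi}$ as its most pulled arm $\arg\max_iN^k_{{\rm Lo},w}(i)$, then $w^k$ is such a $w$; else $w^k\sim\mathrm{Unif}(\mathcal I^k)$. Pull $\pi^k_{\rm Hi}$ in $M_{\rm Hi}$ and $\overline\pi^k_{{\rm Lo},w}$ in $M_{{\rm Lo},w}$ for every $w$, and update. **Lemma (Absorbing to similar task).** There are absolute constants $c^*,C>0$ such that the following holds for all $A$, $W$, all tasks as above and all $\alpha>2$. If at least one source task $M_{{\rm Lo},w^*}$ is $\tilde\Delta_{\min}/4$-close to $M_{\rm Hi}$ and the algorithm is run with $\epsilon=\tilde\Delta_{\min}/4$, then for every $$k\ \ge\ k^*:=c^*\,\frac{\alpha A}{\Delta_{\min}^2}\,\log\frac{\alpha AW}{\Delta_{\min}}$$ one has $$\Pr\big(\pi^k_{\rm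 Hi}\ne i^*_{\rm Hi}\big)\ \le\ C\,\frac{A}{k^{2\alpha-2}}.$$ -/

import Mathlib

open MeasureTheory ProbabilityTheory

noncomputable section

namespace TieredBandit

/-- A stochastic bandit with arms `Fin A`: pulling arm `i` yields a reward drawn from `law i`,
a probability distribution on `[0, 1]`. -/
structure Bandit (A : ℕ) where
  law : Fin A → Measure ℝ
  isProb : ∀ i, IsProbabilityMeasure (law i)
  bounded : ∀ i, ∀ᵐ x ∂(law i), x ∈ Set.Icc (0 : ℝ) 1

instance {A : ℕ} (B : Bandit A) (i : Fin A) : IsProbabilityMeasure (B.law i) := B.isProb i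

variable {A W : ℕ}

/-- The expected reward of arm `i`. -/
def Bandit.mean (B : Bandit A) (i : Fin A) : ℝ := ∫ x, x ∂(B.law i)

/-- The optimal value `max_j μ(j)`. -/
def Bandit.optValue (B : Bandit A) : ℝ := ⨆ j, B.mean j

/-- The gap `Δ(i) = max_j μ(j) - μ(i)`. -/
def Bandit.gap (B : Bandit A) (i : Fin A) : ℝ := B.optValue - B.mean i

def Bandit.IsOptimalArm (B : Bandit A) (i : Fin A) : Prop := ∀ j, B.mean j ≤ B.mean i

/-- A tiered bandit problem: one high-tier task and `W` low-tier (source) tasks. -/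
structure Problem (A W : ℕ) where
  hi : Bandit A
  lo : Fin W → Bandit A

/-- All tasks, indexed by `Option (Fin W)`: `none` is the high-tier task and `some w` is the
`w`-th source task. -/
def Problem.task (M : Problem A W) : Option (Fin W) → Bandit A
  | none => M.hi
  | some w => M.lo w

/-- `Δ_min`: the smallest gap of a non-optimal arm, over all the source tasks and the high-tier
task. -/
def Problem.minGap (M : Problem A W) : ℝ :=
  sInf {d : ℝ | ∃ m : Option (Fin W), ∃ i : Fin A,
    ¬ (M.task m).IsOptimalArm i ∧ d = (M.task m).gap i}

/-- Every task has a unique optimal arm. -/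
def Problem.UniqueOptimalArms (M : Problem A W) : Prop :=
  ∀ m, ∃! i, (M.task m).IsOptimalArm i

/-- Optimal value dominance of every source task over the high-tier task. -/
def Problem.OptimalValueDominance (M : Problem A W) : Prop :=
  ∀ w, M.hi.optValue - M.minGap / 2 ≤ (M.lo w).optValue

/-- The high-tier task is `ε`-close to the source task `w`: the optimal value of the source task
exceeds that of the high-tier task by at most `ε`, and both have the same optimal arm. -/
def Problem.IsClose (M : Problem A W) (ε : ℝ) (w : Fin W) : Prop :=
  (M.lo w).optValue - M.hi.optValue ≤ ε ∧
    ∀ i, M.hi.IsOptimalArm i ↔ (M.lo w).IsOptimalArm i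

/-! ### Randomness -/

/-- Nonempty sets of source tasks. -/
abbrev Cand (W : ℕ) : Type := {S : Finset (Fin W) // S.Nonempty}

/-- The randomness of one iteration: the reward which each arm of each task returns if it is
pulled in this iteration, and for each nonempty set of source tasks a random element of it. -/
abbrev Noise (A W : ℕ) : Type :=
  (Option (Fin W) → Fin A → ℝ) × (Cand W → Fin W)

/-- The law of the randomness of one iteration: rewards follow the reward distributions of the
arms, the element drawn from a set is uniform on it, and all draws are independent. -/
def Problem.noiseLaw (M : Problem A W) : Measure (Noise A W) :=
  (Measure.pi fun m => Measure.pi fun i => (M.task m).law i).prod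
    (Measure.pi fun S : Cand W => (PMF.uniformOfFinset S.1 S.2).toMeasure)

instance (M : Problem A W) : IsProbabilityMeasure M.noiseLaw := by
  unfold Problem.noiseLaw
  infer_instance

/-- The law of the randomness of all iterations (independent over iterations); the coordinate
`ω k` belongs to iteration `k = 1, 2, …`. -/
def Problem.P (M : Problem A W) : Measure (ℕ → Noise A W) :=
  Measure.infinitePi fun _ => M.noiseLaw

instance (M : Problem A W) : IsProbabilityMeasure M.P := by
  unfold Problem.P
  infer_instance

/-! ### The algorithm -/

/-- The choices which the pseudocode leaves open: which maximizer an `argmax` returns (for the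
upper and for the lower confidence bounds), and which of several source tasks is taken when the
previous action is inherited. -/
structure TieBreak (A W : ℕ) where
  upper : ℕ → Option (Fin W) → (Fin A → ℝ) → Fin A
  upper_measurable : ∀ k m, Measurable (upper k m)
  upper_max : ∀ k m (v : Fin A → ℝ) i, v i ≤ v (upper k m v)
  lower : ℕ → Fin W → (Fin A → ℝ) → Fin A
  lower_measurable : ∀ k w, Measurable (lower k w)
  lower_max : ∀ k w (v : Fin A → ℝ) i, v i ≤ v (lower k w v)
  inherit : ℕ → Cand W → Fin W
  inherit_mem : ∀ k S, inherit k S ∈ S.1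

/-- The memory of the algorithm between two iterations: number of pulls and sum of rewards of
each arm in each task, and the trusted source task (`none` for `Null`) and the high-tier arm of
the last iteration. -/
structure State (A W : ℕ) where
  count : Option (Fin W) → Fin A → ℕ
  total : Option (Fin W) → Fin A → ℝ
  prevTask : Option (Fin W)
  prevArm : Option (Fin A)

def State.initial : State A W := ⟨fun _ _ => 0, fun _ _ => 0, none, none⟩

/-- `f(k) = 1 + 16 W A² (k+1)²`. -/
def confLevel (A W k : ℕ) : ℝ := 1 + 16 * W * (A : ℝ) ^ 2 * ((k : ℝ) + 1) ^ 2

/-- Empirical mean reward. -/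
def State.empMean (s : State A W) (m : Option (Fin W)) (i : Fin A) : ℝ :=
  s.total m i / s.count m i

/-- The confidence width `√(2 α log f(k) / N(i))`. -/
def State.width (s : State A W) (α : ℝ) (k : ℕ) (m : Option (Fin W)) (i : Fin A) : ℝ :=
  √(2 * α * Real.log (confLevel A W k) / s.count m i)

def State.ucb (s : State A W) (α : ℝ) (k : ℕ) (m : Option (Fin W)) (i : Fin A) : ℝ :=
  s.empMean m i + s.width α k m i

def State.lcb (s : State A W) (α : ℝ) (k : ℕ) (m : Option (Fin W)) (i : Fin A) : ℝ :=
  s.empMean m i - s.width α k m i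

/-- The arm with the largest upper confidence bound in task `m`. -/
def State.upperArm (s : State A W) (τ : TieBreak A W) (α : ℝ) (k : ℕ) (m : Option (Fin W)) :
    Fin A :=
  τ.upper k m (s.ucb α k m)

/-- The arm with the largest lower confidence bound in source task `w`. -/
def State.lowerArm (s : State A W) (τ : TieBreak A W) (α : ℝ) (k : ℕ) (w : Fin W) : Fin A :=
  τ.lower k w (s.lcb α k (some w))

open Classical in
/-- The set `𝓘ᵏ` of source tasks that pass the checking event. -/
def State.passing (s : State A W) (τ : TieBreak A W) (α ε : ℝ) (k : ℕ) : Finset (Fin W) :=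
  Finset.univ.filter fun w =>
    s.lcb α k (some w) (s.lowerArm τ α k w) ≤ s.ucb α k none (s.lowerArm τ α k w) + ε ∧
      (k : ℝ) / 2 < s.count (some w) (s.lowerArm τ α k w)

open Classical in
/-- The tasks of `𝓘ᵏ` whose most pulled arm is the high-tier arm of the last iteration. -/
def State.inheriting (s : State A W) (τ : TieBreak A W) (α ε : ℝ) (k : ℕ) : Finset (Fin W) :=
  (s.passing τ α ε k).filter fun w =>
    ∃ a, s.prevArm = some a ∧ ∀ j, s.count (some w) j ≤ s.count (some w) a

open Classical in
/-- The trusted task `wᵏ` (`none` for `Null`) in an iteration `k > A`; `draw` holds the uniform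
draws of this iteration. -/
def State.select (s : State A W) (τ : TieBreak A W) (α ε : ℝ) (k : ℕ) (draw : Cand W → Fin W) :
    Option (Fin W) :=
  if hI : (s.passing τ α ε k).Nonempty then
    match s.prevTask with
    | none => some (draw ⟨s.passing τ α ε k, hI⟩)
    | some v =>
      if v ∈ s.passing τ α ε k then some v
      else if hJ : (s.inheriting τ α ε k).Nonempty then
        some (τ.inherit k ⟨s.inheriting τ α ε k, hJ⟩)
      else some (draw ⟨s.passing τ α ε k, hI⟩)
  else none

/-- The choices made in one iteration: the arm pulled in each task and the trusted task. -/
structure Decision (A W : ℕ) where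
  arm : Option (Fin W) → Fin A
  trusted : Option (Fin W)

/-- The choices in iteration `k`. In the first `A` iterations the arms are pulled in turn.
Afterwards every source task follows its upper confidence bounds, and the high-tier task follows
the lower confidence bounds of the trusted task, or its own upper confidence bounds if there is
no trusted task. -/
def State.decide (s : State A W) (τ : TieBreak A W) (α ε : ℝ) (k : ℕ) (x : Noise A W) :
    Decision A W :=
  if h : k - 1 < A then ⟨fun _ => ⟨k - 1, h⟩, none⟩
  else
    { trusted := s.select τ α ε k x.2
      arm := fun m =>
        match m with
        | some w => s.upperArm τ α k (some w)
        | none =>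
          match s.select τ α ε k x.2 with
          | none => s.upperArm τ α k none
          | some w => s.lowerArm τ α k w }

/-- Iteration `k`: choose, interact with all the tasks, update. -/
def State.step (s : State A W) (τ : TieBreak A W) (α ε : ℝ) (k : ℕ) (x : Noise A W) :
    State A W where
  count := fun m i => s.count m i + if (s.decide τ α ε k x).arm m = i then 1 else 0
  total := fun m i => s.total m i + if (s.decide τ α ε k x).arm m = i then x.1 m i else 0
  prevTask := (s.decide τ α ε k x).trusted
  prevArm := some ((s.decide τ α ε k x).arm none)

/-- The memory after the iterations `1, …, n`. -/
def stateAfter (τ : TieBreak A W) (α ε : ℝ) (ω : ℕ → Noise A W) : ℕ → State A W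
  | 0 => State.initial
  | n + 1 => (stateAfter τ α ε ω n).step τ α ε (n + 1) (ω (n + 1))

/-- The high-tier arm pulled in iteration `k ≥ 1`. -/
def armHi (τ : TieBreak A W) (α ε : ℝ) (k : ℕ) (ω : ℕ → Noise A W) : Fin A :=
  ((stateAfter τ α ε ω (k - 1)).decide τ α ε k (ω k)).arm none

end TieredBandit

end

noncomputable section

namespace TieredBandit

variable {A W : ℕ}

/-! ### Means, optimal arms and gaps -/

/-! The error event is contained, up to a null set, in the event that some confidence interval fails
in a window of iterations ending at `k`. Inside the window everything is deterministic. Put `L = 2α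
log f(k) / Δ²` and `a = ⌊k/16⌋`, `b = ⌊k/2⌋`.

With valid intervals, a source task pulls a suboptimal arm only while its count is at most `4L`.
Hence from `b` on its optimal arm holds more than half of the pulls (`FavorableRun.half_lt_count`),
so it is the most pulled arm and also the maximizer of the lower bounds. The close task therefore
always passes the check, and the trusted task is never `Null`. A task with a wrong optimal arm
passes only while the high tier has pulled that arm at most `256L` times, because value dominance
and `ε ≤ Δ/4` force a wide high-tier interval (`State.Accurate.count_le_of_mem_passing`). Counting
pulls, the high tier must pull its optimal arm at some time in `[b, N)`, where `N = k - 1`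
(`FavorableRun.exists_armAt`). From then on it never leaves it: either the trusted task is kept, or
the action is inherited by a task with the same leading arm, and the close task guarantees that such
a task exists (`FavorableRun.armAt_succ`).

For the probability, the number of pulls is random and depends on past rewards, so Hoeffding's
inequality is replaced by an exponential supermartingale, with a union over the possible counts,
arms and tasks. Each interval fails with probability at most `2 f^(-4α)`; the factor `W` inside `f`
pays for the union over tasks, and summing over at most `k` counts and `k` iterations turns
`k^(-2α)` into `k^(2-2α)`. Finally, `k ≥ k*` is what makes `A(1 + L)` a small fraction of `k`,
although `L` itself contains `log k` (`mul_pullScale_le`). -/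

theorem Bandit.mean_mem_Icc (B : Bandit A) (i : Fin A) : B.mean i ∈ Set.Icc (0 : ℝ) 1 := by
  have hint : Integrable (fun x : ℝ => x) (B.law i) :=
    Integrable.of_mem_Icc 0 1 aemeasurable_id (B.bounded i)
  constructor
  · exact integral_nonneg_of_ae ((B.bounded i).mono fun x hx => hx.1)
  · have := integral_mono_ae hint (integrable_const (1 : ℝ))
      ((B.bounded i).mono fun x hx => hx.2)
    simpa [Bandit.mean] using this

theorem Bandit.IsOptimalArm.optValue_eq {B : Bandit A} {i : Fin A} (h : B.IsOptimalArm i) :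
    B.optValue = B.mean i := by
  have : Nonempty (Fin A) := ⟨i⟩
  exact le_antisymm (ciSup_le h) (le_ciSup (Set.finite_range _).bddAbove i)

theorem Bandit.mean_le_optValue (B : Bandit A) (i : Fin A) : B.mean i ≤ B.optValue :=
  le_ciSup (Set.finite_range B.mean).bddAbove i

theorem Problem.minGap_le_gap (M : Problem A W) {m : Option (Fin W)} {i : Fin A}
    (h : ¬ (M.task m).IsOptimalArm i) : M.minGap ≤ (M.task m).gap i := by
  refine csInf_le ⟨0, ?_⟩ ⟨m, i, h, rfl⟩
  rintro d ⟨m, i, -, rfl⟩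
  exact sub_nonneg.2 ((M.task m).mean_le_optValue i)

theorem Problem.exists_not_isOptimalArm (M : Problem A W) (h : 0 < M.minGap) :
    ∃ m i, ¬ (M.task m).IsOptimalArm i := by
  by_contra! hcon
  have : {d : ℝ | ∃ m : Option (Fin W), ∃ i : Fin A,
      ¬ (M.task m).IsOptimalArm i ∧ d = (M.task m).gap i} = ∅ := by
    ext d
    simp [hcon]
  -- The infimum of the empty set is `0` by convention, so a positive gap certifies that a
  -- non-optimal arm exists.
  rw [Problem.minGap, this, Real.sInf_empty] at h
  exact lt_irrefl _ h

theorem Problem.minGap_le_one (M : Problem A W) (h : 0 < M.minGap) : M.minGap ≤ 1 := by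
  obtain ⟨m, i, hi⟩ := M.exists_not_isOptimalArm h
  refine (M.minGap_le_gap hi).trans ?_
  have : Nonempty (Fin A) := ⟨i⟩
  have h1 : (M.task m).optValue ≤ 1 := ciSup_le fun j => ((M.task m).mean_mem_Icc j).2
  have h0 := ((M.task m).mean_mem_Icc i).1
  unfold Bandit.gap
  linarith

theorem Problem.two_le_arms (M : Problem A W) (h : 0 < M.minGap) : 2 ≤ A := by
  obtain ⟨m, i, hi⟩ := M.exists_not_isOptimalArm h
  by_contra! hA
  refine hi fun j => le_of_eq ?_
  congr 1
  ext
  omega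

/-- The optimal arms of all tasks, separated from the other arms by a gap of at least `Δ`. -/
structure Problem.Separated (M : Problem A W) (opt : Option (Fin W) → Fin A) (Δ : ℝ) : Prop where
  mean_le : ∀ m i, i ≠ opt m → (M.task m).mean i ≤ (M.task m).mean (opt m) - Δ

theorem Problem.exists_separated (M : Problem A W) (h : M.UniqueOptimalArms) :
    ∃ opt : Option (Fin W) → Fin A,
      (∀ m i, (M.task m).IsOptimalArm i ↔ i = opt m) ∧ M.Separated opt M.minGap := by
  choose opt hopt huniq using h
  have hiff : ∀ m i, (M.task m).IsOptimalArm i ↔ i = opt m := fun m i =>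
    ⟨huniq m i, fun hi => hi ▸ hopt m⟩
  refine ⟨opt, hiff, ⟨fun m i hi => ?_⟩⟩
  have h1 := M.minGap_le_gap (m := m) (i := i) (fun hc => hi ((hiff m i).1 hc))
  have h2 : (M.task m).optValue = (M.task m).mean (opt m) := (hopt m).optValue_eq
  unfold Bandit.gap at h1
  linarith

/-! ### Numbers of pulls -/

section Path

variable (τ : TieBreak A W) (α ε : ℝ) (ω : ℕ → Noise A W)

/-- The arm of task `m` that is pulled in iteration `n + 1`. -/
def armAt (n : ℕ) (m : Option (Fin W)) : Fin A :=
  ((stateAfter τ α ε ω n).decide τ α ε (n + 1) (ω (n + 1))).arm m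

theorem count_succ (n : ℕ) (m : Option (Fin W)) (i : Fin A) :
    (stateAfter τ α ε ω (n + 1)).count m i =
      (stateAfter τ α ε ω n).count m i + if armAt τ α ε ω n m = i then 1 else 0 := rfl

theorem count_mono (m : Option (Fin W)) (i : Fin A) :
    Monotone fun n => (stateAfter τ α ε ω n).count m i :=
  monotone_nat_of_le_succ fun n => by rw [count_succ]; exact Nat.le_add_right _ _

theorem sum_count (n : ℕ) (m : Option (Fin W)) :
    ∑ i, (stateAfter τ α ε ω n).count m i = n := by
  induction n with
  | zero => simp [stateAfter, State.initial]
  | succ n ih => simp [count_succ, Finset.sum_add_distrib, ih]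

theorem count_le (n : ℕ) (m : Option (Fin W)) (i : Fin A) :
    (stateAfter τ α ε ω n).count m i ≤ n := by
  conv_rhs => rw [← sum_count τ α ε ω n m]
  exact Finset.single_le_sum (f := fun i => (stateAfter τ α ε ω n).count m i)
    (fun _ _ => Nat.zero_le _) (Finset.mem_univ i)

theorem armAt_of_lt {n : ℕ} (h : n < A) (m : Option (Fin W)) :
    armAt τ α ε ω n m = ⟨n, h⟩ := by
  simp [armAt, State.decide, h]

theorem one_le_count {n : ℕ} (hn : A ≤ n) (m : Option (Fin W)) (i : Fin A) :
    1 ≤ (stateAfter τ α ε ω n).count m i := by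
  refine le_trans ?_ (count_mono τ α ε ω m i (i.2.trans_le hn : i.1 + 1 ≤ n))
  simp [count_succ, armAt_of_lt τ α ε ω i.2]

theorem armAt_some {n : ℕ} (h : A ≤ n) (w : Fin W) :
    armAt τ α ε ω n (some w) = (stateAfter τ α ε ω n).upperArm τ α (n + 1) (some w) := by
  simp [armAt, State.decide, not_lt.2 h]

theorem armAt_none {n : ℕ} (h : A ≤ n) {w : Fin W}
    (hw : (stateAfter τ α ε ω n).select τ α ε (n + 1) (ω (n + 1)).2 = some w) :
    armAt τ α ε ω n none = (stateAfter τ α ε ω n).lowerArm τ α (n + 1) w := by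
  simp [armAt, State.decide, not_lt.2 h, hw]

theorem prevTask_succ {n : ℕ} (h : A ≤ n) :
    (stateAfter τ α ε ω (n + 1)).prevTask =
      (stateAfter τ α ε ω n).select τ α ε (n + 1) (ω (n + 1)).2 := by
  simp [stateAfter, State.step, State.decide, not_lt.2 h]

theorem prevArm_succ (n : ℕ) :
    (stateAfter τ α ε ω (n + 1)).prevArm = some (armAt τ α ε ω n none) := rfl

/-- If an arm is pulled only while its number of pulls is at most `U`, then it is pulled at most
`U + 1` times. -/
theorem count_le_add (m : Option (Fin W)) (i : Fin A) {U : ℝ} (hU : 0 ≤ U) {a b : ℕ}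
    (hab : a ≤ b)
    (h : ∀ n, a ≤ n → n < b → armAt τ α ε ω n m = i →
      ((stateAfter τ α ε ω n).count m i : ℝ) ≤ U) :
    ((stateAfter τ α ε ω b).count m i : ℝ) ≤ (stateAfter τ α ε ω a).count m i + (U + 1) := by
  induction b, hab using Nat.le_induction with
  | base => linarith
  | succ b hab ih =>
    rw [count_succ]
    split_ifs with hi
    · have := h b hab (Nat.lt_succ_self b) hi
      have h0 : (0 : ℝ) ≤ (stateAfter τ α ε ω a).count m i := Nat.cast_nonneg _
      push_cast
      linarith
    · simpa using ih fun n h1 h2 => h n h1 (h2.trans (Nat.lt_succ_self b))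

/-- If all arms but `i` are pulled only while their number of pulls is at most `U`, then arm `i`
receives the remaining pulls. -/
theorem le_count_of_others (m : Option (Fin W)) (i : Fin A) {U : ℝ} (hU : 0 ≤ U) {a b : ℕ}
    (hab : a ≤ b)
    (h : ∀ n, a ≤ n → n < b → armAt τ α ε ω n m ≠ i →
      ((stateAfter τ α ε ω n).count m (armAt τ α ε ω n m) : ℝ) ≤ U) :
    (b : ℝ) - a - A * (U + 1) + (stateAfter τ α ε ω a).count m i ≤
      (stateAfter τ α ε ω b).count m i := by
  have hb : ∑ j, ((stateAfter τ α ε ω b).count m j : ℝ) = b := by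
    exact_mod_cast sum_count τ α ε ω b m
  have ha : ∑ j, ((stateAfter τ α ε ω a).count m j : ℝ) = a := by
    exact_mod_cast sum_count τ α ε ω a m
  rw [← Finset.add_sum_erase _ _ (Finset.mem_univ i)] at hb ha
  have hle : ∑ j ∈ Finset.univ.erase i, ((stateAfter τ α ε ω b).count m j : ℝ) ≤
      ∑ j ∈ Finset.univ.erase i, (((stateAfter τ α ε ω a).count m j : ℝ) + (U + 1)) := by
    refine Finset.sum_le_sum fun j hj => count_le_add τ α ε ω m j hU hab fun n h1 h2 h3 => ?_
    have := h n h1 h2 (h3.trans_ne (Finset.ne_of_mem_erase hj))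
    rwa [h3] at this
  rw [Finset.sum_add_distrib, Finset.sum_const, nsmul_eq_mul] at hle
  have hcard : ((Finset.univ.erase i).card : ℝ) ≤ A := by
    exact_mod_cast (Finset.card_le_univ _).trans (by simp)
  have := mul_le_mul_of_nonneg_right hcard (by linarith : 0 ≤ U + 1)
  linarith

end Path

/-! ### Confidence bounds -/

theorem one_le_confLevel (A W k : ℕ) : 1 ≤ confLevel A W k := by
  unfold confLevel
  have : (0 : ℝ) ≤ 16 * W * (A : ℝ) ^ 2 * ((k : ℝ) + 1) ^ 2 := by positivity
  linarith

theorem confLevel_mono (A W : ℕ) {k l : ℕ} (h : k ≤ l) : confLevel A W k ≤ confLevel A W l := by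
  unfold confLevel
  gcongr

theorem log_confLevel_nonneg (A W k : ℕ) : 0 ≤ Real.log (confLevel A W k) :=
  Real.log_nonneg (one_le_confLevel A W k)

/-- All empirical means are within the confidence width of the true means. -/
def State.Accurate (s : State A W) (M : Problem A W) (α : ℝ) (k : ℕ) : Prop :=
  ∀ m i, |s.empMean m i - (M.task m).mean i| ≤ s.width α k m i

namespace State

variable {s : State A W} {M : Problem A W} {α : ℝ} {k : ℕ}

theorem Accurate.mean_le_ucb (h : s.Accurate M α k) (m : Option (Fin W)) (i : Fin A) :
    (M.task m).mean i ≤ s.ucb α k m i := by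
  have := (abs_le.1 (h m i)).1
  unfold ucb; linarith

theorem Accurate.ucb_le (h : s.Accurate M α k) (m : Option (Fin W)) (i : Fin A) :
    s.ucb α k m i ≤ (M.task m).mean i + 2 * s.width α k m i := by
  have := (abs_le.1 (h m i)).2
  unfold ucb; linarith

theorem Accurate.lcb_le_mean (h : s.Accurate M α k) (m : Option (Fin W)) (i : Fin A) :
    s.lcb α k m i ≤ (M.task m).mean i := by
  have := (abs_le.1 (h m i)).2
  unfold lcb; linarith

theorem Accurate.le_lcb (h : s.Accurate M α k) (m : Option (Fin W)) (i : Fin A) :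
    (M.task m).mean i - 2 * s.width α k m i ≤ s.lcb α k m i := by
  have := (abs_le.1 (h m i)).1
  unfold lcb; linarith

theorem count_le_of_le_width {d : ℝ} (hd : 0 < d) {m : Option (Fin W)} {i : Fin A}
    (hs : 0 < s.count m i) (h : d ≤ s.width α k m i) :
    (s.count m i : ℝ) ≤ 2 * α * Real.log (confLevel A W k) / d ^ 2 := by
  have hN : (0 : ℝ) < s.count m i := by exact_mod_cast hs
  have h2 := (Real.le_sqrt' hd).1 h
  rw [le_div_iff₀ hN] at h2
  rw [le_div_iff₀ (by positivity)]
  linarith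

theorem width_le_of_le_count {d : ℝ} (hd : 0 < d) {m : Option (Fin W)} {i : Fin A}
    (hs : 0 < s.count m i)
    (h : 2 * α * Real.log (confLevel A W k) / d ^ 2 ≤ (s.count m i : ℝ)) :
    s.width α k m i ≤ d := by
  have hN : (0 : ℝ) < s.count m i := by exact_mod_cast hs
  refine Real.sqrt_le_iff.2 ⟨hd.le, ?_⟩
  rw [div_le_iff₀ (by positivity)] at h
  rw [div_le_iff₀ hN]
  linarith

variable {τ : TieBreak A W} {opt : Option (Fin W) → Fin A} {Δ ε : ℝ}

/-- A suboptimal arm maximizes the upper confidence bounds only if it was pulled rarely. -/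
theorem Accurate.count_upperArm_le (h : s.Accurate M α k) (hM : M.Separated opt Δ) (hΔ : 0 < Δ)
    {m : Option (Fin W)} (hpos : ∀ i, 0 < s.count m i) (hne : s.upperArm τ α k m ≠ opt m) :
    (s.count m (s.upperArm τ α k m) : ℝ) ≤
      2 * α * Real.log (confLevel A W k) / (Δ / 2) ^ 2 := by
  refine count_le_of_le_width (by positivity) (hpos _) ?_
  have h1 := h.mean_le_ucb m (opt m)
  have h2 : s.ucb α k m (opt m) ≤ s.ucb α k m (s.upperArm τ α k m) := τ.upper_max k m _ _
  have h3 := h.ucb_le m (s.upperArm τ α k m)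
  have h4 := hM.mean_le m _ hne
  linarith

/-- The lower bound of the optimal arm loses at most `Δ/8`, whereas every other lower bound stays
below its own mean, which is `Δ` lower. -/
theorem Accurate.lowerArm_eq (h : s.Accurate M α k) (hM : M.Separated opt Δ) (hΔ : 0 < Δ)
    {w : Fin W} (hw : s.width α k (some w) (opt (some w)) ≤ Δ / 16) :
    s.lowerArm τ α k w = opt (some w) := by
  by_contra hne
  have h1 := h.le_lcb (some w) (opt (some w))
  have h2 : s.lcb α k (some w) (opt (some w)) ≤ s.lcb α k (some w) (s.lowerArm τ α k w) :=
    τ.lower_max k w _ _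
  have h3 := h.lcb_le_mean (some w) (s.lowerArm τ α k w)
  have h4 := hM.mean_le (some w) _ hne
  linarith

theorem mem_passing {w : Fin W} : w ∈ s.passing τ α ε k ↔
    s.lcb α k (some w) (s.lowerArm τ α k w) ≤ s.ucb α k none (s.lowerArm τ α k w) + ε ∧
      (k : ℝ) / 2 < s.count (some w) (s.lowerArm τ α k w) := by
  simp [passing]

theorem mem_inheriting {w : Fin W} : w ∈ s.inheriting τ α ε k ↔ w ∈ s.passing τ α ε k ∧
    ∃ a, s.prevArm = some a ∧ ∀ j, s.count (some w) j ≤ s.count (some w) a := by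
  simp [inheriting]

/-- Valid intervals can only help the check: the left side lies below the source mean and the right
side above the high-tier mean plus `ε`. -/
theorem Accurate.mem_passing_of_close (h : s.Accurate M α k) {w : Fin W} {i : Fin A}
    (hl : s.lowerArm τ α k w = i) (hN : (k : ℝ) / 2 < s.count (some w) i)
    (hclose : (M.lo w).mean i ≤ M.hi.mean i + ε) : w ∈ s.passing τ α ε k := by
  rw [mem_passing, hl]
  refine ⟨?_, hN⟩
  have h1 : s.lcb α k (some w) i ≤ (M.lo w).mean i := h.lcb_le_mean (some w) i
  have h2 : M.hi.mean i ≤ s.ucb α k none i := h.mean_le_ucb none i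
  linarith

/-- A source task with the wrong optimal arm passes the check only if this arm was pulled rarely
in the high-tier task. -/
theorem Accurate.count_le_of_mem_passing (h : s.Accurate M α k) (hM : M.Separated opt Δ)
    (hΔ : 0 < Δ) (hε : ε ≤ Δ / 4) {w : Fin W} (hpos : ∀ i, 0 < s.count none i)
    (hdom : M.hi.mean (opt none) - Δ / 2 ≤ (M.lo w).mean (opt (some w)))
    (hne : opt (some w) ≠ opt none)
    (hw : s.width α k (some w) (opt (some w)) ≤ Δ / 16) (hpass : w ∈ s.passing τ α ε k) :
    (s.count none (opt (some w)) : ℝ) ≤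
      2 * α * Real.log (confLevel A W k) / (Δ / 16) ^ 2 := by
  refine count_le_of_le_width (by positivity) (hpos _) ?_
  -- At this arm the source mean exceeds the high-tier mean by at least `Δ - Δ/2`. The source
  -- interval absorbs `Δ/8` and `ε` absorbs `Δ/4`, so twice the high-tier width must cover the
  -- remaining `Δ/8`.
  have h0 := (mem_passing.1 hpass).1
  rw [h.lowerArm_eq hM hΔ hw] at h0
  have h1 : (M.lo w).mean (opt (some w)) - _ ≤ _ := h.le_lcb (some w) (opt (some w))
  have h2 : _ ≤ M.hi.mean (opt (some w)) + _ := h.ucb_le none (opt (some w))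
  have h3 : M.hi.mean (opt (some w)) ≤ M.hi.mean (opt none) - Δ := hM.mean_le none _ hne
  linarith

theorem exists_select_eq_some {draw : Cand W → Fin W}
    (hne : (s.passing τ α ε k).Nonempty) : ∃ w, s.select τ α ε k draw = some w := by
  unfold select
  rw [dif_pos hne]
  split
  · exact ⟨_, rfl⟩
  · split_ifs <;> exact ⟨_, rfl⟩

/-- The membership hypothesis on `draw` is needed because a point of the sample space may carry an
arbitrary function; it holds only almost surely. -/
theorem mem_passing_of_select {draw : Cand W → Fin W} (hdraw : ∀ S, draw S ∈ S.1) {w : Fin W}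
    (h : s.select τ α ε k draw = some w) : w ∈ s.passing τ α ε k := by
  unfold select at h
  by_cases hI : (s.passing τ α ε k).Nonempty
  swap
  · simp [hI] at h
  rw [dif_pos hI] at h
  split at h
  · obtain rfl := Option.some.inj h
    exact hdraw ⟨_, hI⟩
  · split_ifs at h with hv hJ
    · obtain rfl := Option.some.inj h
      exact hv
    · obtain rfl := Option.some.inj h
      exact (mem_inheriting.1 (τ.inherit_mem k ⟨_, hJ⟩)).1
    · obtain rfl := Option.some.inj h
      exact hdraw ⟨_, hI⟩

end State

/-! ### Runs with accurate estimates -/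

/-- Arms with a gap of order `Δ` are separated after this number of pulls, up to a constant. -/
def pullScale (A W : ℕ) (α Δ : ℝ) (N : ℕ) : ℝ :=
  2 * α * Real.log (confLevel A W (N + 1)) / Δ ^ 2

/-- A run whose estimates are accurate after the iterations `a, …, N`, where iteration `b` is late
enough for every source task to have identified its optimal arm. -/
structure FavorableRun (M : Problem A W) (τ : TieBreak A W) (α ε : ℝ) (ω : ℕ → Noise A W)
    (opt : Option (Fin W) → Fin A) (Δ : ℝ) (a b N : ℕ) : Prop where
  separated : M.Separated opt Δ
  gap_pos : 0 < Δ
  alpha_nonneg : 0 ≤ α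
  eps_le : ε ≤ Δ / 4
  dominance : ∀ w, M.hi.mean (opt none) - Δ / 2 ≤ (M.lo w).mean (opt (some w))
  close : ∃ w, opt (some w) = opt none ∧ (M.lo w).mean (opt none) ≤ M.hi.mean (opt none) + ε
  arms_le : A ≤ a
  le : a ≤ b
  draw_mem : ∀ n S, (ω n).2 S ∈ S.1
  accurate : ∀ n, a ≤ n → n ≤ N → (stateAfter τ α ε ω n).Accurate M α (n + 1)
  half_lt : ((b : ℝ) + 1) / 2 < b - a - A * (4 * pullScale A W α Δ N + 1)
  scale_le : 256 * pullScale A W α Δ N ≤ (b : ℝ) / 2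

theorem pullScale_nonneg {α : ℝ} (hα : 0 ≤ α) (Δ : ℝ) (N : ℕ) : 0 ≤ pullScale A W α Δ N := by
  have := log_confLevel_nonneg A W (N + 1)
  unfold pullScale
  positivity

/-- Monotonicity of `f` lets a single scale, taken at the horizon `N`, dominate the thresholds of
all earlier iterations. -/
theorem le_mul_pullScale {α Δ : ℝ} (hα : 0 ≤ α) (c : ℝ) {n N : ℕ} (h : n ≤ N) :
    2 * α * Real.log (confLevel A W (n + 1)) / (Δ / c) ^ 2 ≤ c ^ 2 * pullScale A W α Δ N := by
  have h1 : Real.log (confLevel A W (n + 1)) ≤ Real.log (confLevel A W (N + 1)) :=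
    Real.log_le_log (by linarith [one_le_confLevel A W (n + 1)]) (confLevel_mono A W (by omega))
  have h2 : 2 * α * Real.log (confLevel A W (n + 1)) / (Δ / c) ^ 2 =
      c ^ 2 * (2 * α * Real.log (confLevel A W (n + 1)) / Δ ^ 2) := by
    rw [div_pow, div_div_eq_mul_div]; ring
  rw [h2]
  unfold pullScale
  gcongr

namespace FavorableRun

variable {M : Problem A W} {τ : TieBreak A W} {α ε : ℝ} {ω : ℕ → Noise A W}
  {opt : Option (Fin W) → Fin A} {Δ : ℝ} {a b N : ℕ}

theorem count_pos (h : FavorableRun M τ α ε ω opt Δ a b N) {n : ℕ} (hn : a ≤ n)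
    (m : Option (Fin W)) (i : Fin A) : 0 < (stateAfter τ α ε ω n).count m i :=
  one_le_count τ α ε ω (h.arms_le.trans hn) m i

/-- Suboptimal arms consume at most `A(4L + 1)` pulls after `a`. The majority assumed at `b`
persists, since each further iteration adds one to the guaranteed count and only one half to the
threshold. -/
theorem half_lt_count (h : FavorableRun M τ α ε ω opt Δ a b N) {n : ℕ} (hn : b ≤ n)
    (hN : n ≤ N) (w : Fin W) :
    ((n + 1 : ℕ) : ℝ) / 2 < (stateAfter τ α ε ω n).count (some w) (opt (some w)) := by
  have h1 := le_count_of_others τ α ε ω (some w) (opt (some w))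
    (U := 4 * pullScale A W α Δ N) (a := a) (b := n)
    (by have := pullScale_nonneg (A := A) (W := W) h.alpha_nonneg Δ N; positivity)
    (h.le.trans hn) fun l hl hln hne => ?_
  · have h2 := h.half_lt
    have h3 : (b : ℝ) ≤ n := by exact_mod_cast hn
    have h4 : (0 : ℝ) ≤ (stateAfter τ α ε ω a).count (some w) (opt (some w)) :=
      Nat.cast_nonneg _
    push_cast
    linarith
  · rw [armAt_some τ α ε ω (h.arms_le.trans hl)] at hne ⊢
    refine ((h.accurate l hl (by omega)).count_upperArm_le h.separated h.gap_pos
      (h.count_pos hl _) hne).trans ?_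
    have := le_mul_pullScale (A := A) (W := W) (Δ := Δ) h.alpha_nonneg 2
      (show l ≤ N by omega)
    linarith

theorem width_le (h : FavorableRun M τ α ε ω opt Δ a b N) {n : ℕ} (hn : b ≤ n)
    (hN : n ≤ N) (w : Fin W) :
    (stateAfter τ α ε ω n).width α (n + 1) (some w) (opt (some w)) ≤ Δ / 16 := by
  have hΔ := h.gap_pos
  refine State.width_le_of_le_count (by positivity) (h.count_pos (h.le.trans hn) _ _) ?_
  have h1 := le_mul_pullScale (A := A) (W := W) (Δ := Δ) h.alpha_nonneg 16 hN
  have h2 := h.half_lt_count hn hN w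
  have h3 := h.scale_le
  have h4 : (b : ℝ) ≤ n := by exact_mod_cast hn
  push_cast at h2
  linarith

theorem lowerArm_eq (h : FavorableRun M τ α ε ω opt Δ a b N) {n : ℕ} (hn : b ≤ n)
    (hN : n ≤ N) (w : Fin W) :
    (stateAfter τ α ε ω n).lowerArm τ α (n + 1) w = opt (some w) :=
  (h.accurate n (h.le.trans hn) hN).lowerArm_eq h.separated h.gap_pos (h.width_le hn hN w)

theorem mem_passing (h : FavorableRun M τ α ε ω opt Δ a b N) {n : ℕ} (hn : b ≤ n)
    (hN : n ≤ N) {w : Fin W} (hw : opt (some w) = opt none)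
    (hc : (M.lo w).mean (opt none) ≤ M.hi.mean (opt none) + ε) :
    w ∈ (stateAfter τ α ε ω n).passing τ α ε (n + 1) :=
  (h.accurate n (h.le.trans hn) hN).mem_passing_of_close
    ((h.lowerArm_eq hn hN w).trans hw) (by simpa [hw] using h.half_lt_count hn hN w) hc

/-- Two different arms cannot both hold more than half of the pulls, so the inheritance rule sees
exactly the optimal arm of a source. -/
theorem eq_opt_of_forall_count_le (h : FavorableRun M τ α ε ω opt Δ a b N) {n : ℕ} (hn : b ≤ n)
    (hN : n ≤ N) {w : Fin W} {i : Fin A}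
    (hi : ∀ j, (stateAfter τ α ε ω n).count (some w) j ≤
      (stateAfter τ α ε ω n).count (some w) i) : i = opt (some w) := by
  by_contra hne
  have h1 := h.half_lt_count hn hN w
  have h2 : ((stateAfter τ α ε ω n).count (some w) (opt (some w)) : ℝ) ≤
      (stateAfter τ α ε ω n).count (some w) i := by exact_mod_cast hi _
  have h3 : (stateAfter τ α ε ω n).count (some w) i +
      (stateAfter τ α ε ω n).count (some w) (opt (some w)) ≤ n := by
    conv_rhs => rw [← sum_count τ α ε ω n (some w)]
    rw [← Finset.sum_pair hne]
    exact Finset.sum_le_sum_of_subset (Finset.subset_univ _)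
  have h4 : ((stateAfter τ α ε ω n).count (some w) i : ℝ) +
      (stateAfter τ α ε ω n).count (some w) (opt (some w)) ≤ n := by exact_mod_cast h3
  push_cast at h1
  linarith

/-- In late iterations some source task is trusted and its optimal arm is pulled. -/
theorem exists_select (h : FavorableRun M τ α ε ω opt Δ a b N) {n : ℕ} (hn : b ≤ n)
    (hN : n ≤ N) : ∃ w, (stateAfter τ α ε ω n).select τ α ε (n + 1) (ω (n + 1)).2 = some w ∧
      armAt τ α ε ω n none = opt (some w) := by
  obtain ⟨v, hv, hc⟩ := h.close
  obtain ⟨w, hw⟩ := State.exists_select_eq_some (draw := (ω (n + 1)).2)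
    ⟨v, h.mem_passing hn hN hv hc⟩
  refine ⟨w, hw, ?_⟩
  rw [armAt_none τ α ε ω (h.arms_le.trans (h.le.trans hn)) hw, h.lowerArm_eq hn hN]

/-- Once the optimal arm is pulled in a late iteration, it is pulled in the next one. -/
theorem armAt_succ (h : FavorableRun M τ α ε ω opt Δ a b N) {n : ℕ} (hn : b ≤ n)
    (hN : n + 1 ≤ N) (hopt : armAt τ α ε ω n none = opt none) :
    armAt τ α ε ω (n + 1) none = opt none := by
  obtain ⟨w, hsel, harm⟩ := h.exists_select hn (by omega)
  obtain ⟨v, hv, hc⟩ := h.close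
  have hb : b ≤ n + 1 := by omega
  have hprev := (prevTask_succ τ α ε ω (h.arms_le.trans (h.le.trans hn))).trans hsel
  -- The close task is an admissible heir: it passes, and its most pulled arm is the arm just
  -- played. This excludes the uniform draw below.
  have hinh : ((stateAfter τ α ε ω (n + 1)).inheriting τ α ε (n + 1 + 1)).Nonempty := by
    refine ⟨v, State.mem_inheriting.2 ⟨h.mem_passing hb hN hv hc, opt none, ?_, fun j => ?_⟩⟩
    · rw [prevArm_succ, hopt]
    · by_contra! hlt
      have hj : ∀ i, (stateAfter τ α ε ω (n + 1)).count (some v) i ≤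
          (stateAfter τ α ε ω (n + 1)).count (some v) (opt (some v)) := by
        have : Nonempty (Fin A) := ⟨j⟩
        obtain ⟨i, hi⟩ := Finite.exists_max fun i =>
          (stateAfter τ α ε ω (n + 1)).count (some v) i
        rwa [h.eq_opt_of_forall_count_le hb hN hi] at hi
      rw [hv] at hj
      exact absurd (hj j) (not_le.2 hlt)
  obtain ⟨u, hu, harm'⟩ := h.exists_select hb hN
  rw [harm']
  unfold State.select at hu
  rw [dif_pos ⟨v, h.mem_passing hb hN hv hc⟩, hprev] at hu
  dsimp only at hu
  -- Two cases survive: the old trusted task still passes and shares the optimal arm, or an heir is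
  -- taken, whose leading arm is by construction the arm just played.
  split_ifs at hu with hmem
  · obtain rfl := Option.some.inj hu
    exact harm.symm.trans hopt
  · have hu' := Option.some.inj hu
    have hmem' := τ.inherit_mem (n + 1 + 1) ⟨_, hinh⟩
    rw [hu', State.mem_inheriting] at hmem'
    obtain ⟨-, i, hi, hmax⟩ := hmem'
    rw [prevArm_succ, hopt] at hi
    obtain rfl := Option.some.inj hi
    exact (h.eq_opt_of_forall_count_le hb hN hmax).symm

/-- The optimal arm is pulled in the high-tier task in some late iteration. -/
theorem exists_armAt (h : FavorableRun M τ α ε ω opt Δ a b N) (hbN : b ≤ N)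
    (hlarge : A * (256 * pullScale A W α Δ N + 1) < (N : ℝ) - b) :
    ∃ n, b ≤ n ∧ n < N ∧ armAt τ α ε ω n none = opt none := by
  by_contra! hcon
  have hL := pullScale_nonneg (A := A) (W := W) h.alpha_nonneg Δ N
  have h1 := le_count_of_others τ α ε ω none (opt none) (U := 256 * pullScale A W α Δ N)
    (by positivity) hbN fun n hn hlt hne => ?_
  · have h3 : (stateAfter τ α ε ω N).count none (opt none) =
        (stateAfter τ α ε ω b).count none (opt none) := by
      clear h1 hlarge h hL
      induction N, hbN using Nat.le_induction with
      | base => rfl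
      | succ n hn ih =>
        rw [count_succ, if_neg (hcon n hn (Nat.lt_succ_self n)), add_zero]
        exact ih fun l h1 h2 => hcon l h1 (by omega)
    rw [h3] at h1
    linarith
  · obtain ⟨w, hsel, harm⟩ := h.exists_select hn hlt.le
    rw [harm] at hne ⊢
    have hpass := State.mem_passing_of_select (h.draw_mem (n + 1)) hsel
    refine ((h.accurate n (h.le.trans hn) hlt.le).count_le_of_mem_passing h.separated h.gap_pos
      h.eps_le (h.count_pos (h.le.trans hn) _) (h.dominance w) hne
      (h.width_le hn hlt.le w) hpass).trans ?_
    have := le_mul_pullScale (A := A) (W := W) (Δ := Δ) h.alpha_nonneg 16 hlt.le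
    linarith

/-- In a favorable run, the optimal arm of the high-tier task is pulled in the last iteration. -/
theorem armAt_eq (h : FavorableRun M τ α ε ω opt Δ a b N) (hbN : b ≤ N)
    (hlarge : A * (256 * pullScale A W α Δ N + 1) < (N : ℝ) - b) :
    armAt τ α ε ω N none = opt none := by
  obtain ⟨n, hbn, hnN, hn⟩ := h.exists_armAt hbN hlarge
  suffices ∀ l, n ≤ l → l ≤ N → armAt τ α ε ω l none = opt none from this N hnN.le le_rfl
  intro l hl
  induction l, hl using Nat.le_induction with
  | base => exact fun _ => hn
  | succ l hl ih => exact fun hlN => h.armAt_succ (hbn.trans hl) hlN (ih (by omega))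

end FavorableRun

/-! ### Measurability -/

/-- The memory of the algorithm as a tuple. -/
def State.toProd (s : State A W) :
    ((Option (Fin W) → Fin A → ℕ) × (Option (Fin W) → Fin A → ℝ)) ×
      (Option (Fin W) × Option (Fin A)) :=
  ((s.count, s.total), (s.prevTask, s.prevArm))

/-- The trusted task and the previous arm get the discrete structure, so only the reward totals
carry real-valued measurability. -/
instance State.measurableSpace : MeasurableSpace (State A W) :=
  letI : MeasurableSpace (Option (Fin W)) := ⊤
  let _ : MeasurableSpace (Option (Fin A)) := ⊤
  MeasurableSpace.comap State.toProd inferInstance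

instance Decision.measurableSpace : MeasurableSpace (Decision A W) := ⊤

section

attribute [local instance] Classical.propDecidable

theorem State.measurable_count (m : Option (Fin W)) (i : Fin A) :
    Measurable fun s : State A W => s.count m i := by
  let _ : MeasurableSpace (Option (Fin W)) := ⊤
  let _ : MeasurableSpace (Option (Fin A)) := ⊤
  have h : Measurable (State.toProd (A := A) (W := W)) := comap_measurable _
  exact (measurable_pi_apply i).comp ((measurable_pi_apply m).comp h.fst.fst)

theorem State.measurable_total (m : Option (Fin W)) (i : Fin A) :
    Measurable fun s : State A W => s.total m i := by
  let _ : MeasurableSpace (Option (Fin W)) := ⊤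
  let _ : MeasurableSpace (Option (Fin A)) := ⊤
  have h : Measurable (State.toProd (A := A) (W := W)) := comap_measurable _
  exact (measurable_pi_apply i).comp ((measurable_pi_apply m).comp h.fst.snd)

theorem State.measurable_prev {β : Type*} [MeasurableSpace β]
    (f : Option (Fin W) → Option (Fin A) → β) :
    Measurable fun s : State A W => f s.prevTask s.prevArm := by
  let _ : MeasurableSpace (Option (Fin W)) := ⊤
  let _ : MeasurableSpace (Option (Fin A)) := ⊤
  have h : Measurable (State.toProd (A := A) (W := W)) := comap_measurable _
  exact (Measurable.of_discrete (f := fun p : Option (Fin W) × Option (Fin A) => f p.1 p.2)).comp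
    h.snd

theorem State.measurable_empMean (m : Option (Fin W)) (i : Fin A) :
    Measurable fun s : State A W => s.empMean m i :=
  (State.measurable_total m i).div
    ((Measurable.of_discrete (f := fun n : ℕ => (n : ℝ))).comp (State.measurable_count m i))

theorem State.measurable_width (α : ℝ) (k : ℕ) (m : Option (Fin W)) (i : Fin A) :
    Measurable fun s : State A W => s.width α k m i :=
  (Measurable.of_discrete (f := fun n : ℕ =>
    √(2 * α * Real.log (confLevel A W k) / (n : ℝ)))).comp (State.measurable_count m i)

theorem State.measurable_ucb (α : ℝ) (k : ℕ) (m : Option (Fin W)) :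
    Measurable fun s : State A W => s.ucb α k m :=
  measurable_pi_lambda _ fun i =>
    (State.measurable_empMean m i).add (State.measurable_width α k m i)

theorem State.measurable_lcb (α : ℝ) (k : ℕ) (m : Option (Fin W)) :
    Measurable fun s : State A W => s.lcb α k m :=
  measurable_pi_lambda _ fun i =>
    (State.measurable_empMean m i).sub (State.measurable_width α k m i)

theorem State.measurable_upperArm (τ : TieBreak A W) (α : ℝ) (k : ℕ) (m : Option (Fin W)) :
    Measurable fun s : State A W => s.upperArm τ α k m :=
  (τ.upper_measurable k m).comp (State.measurable_ucb α k m)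

theorem State.measurable_lowerArm (τ : TieBreak A W) (α : ℝ) (k : ℕ) (w : Fin W) :
    Measurable fun s : State A W => s.lowerArm τ α k w :=
  (τ.lower_measurable k w).comp (State.measurable_lcb α k (some w))

theorem measurable_apply_fin {Ω β : Type*} [MeasurableSpace Ω] [MeasurableSpace β]
    {n : ℕ} {g : Ω → Fin n} {F : Ω → Fin n → β} (hg : Measurable g)
    (hF : ∀ i, Measurable fun x => F x i) : Measurable fun x => F x (g x) := by
  have h : Measurable fun p : Fin n × Ω => F p.2 p.1 :=
    measurable_from_prod_countable_right hF
  exact h.comp (hg.prodMk measurable_id)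

theorem measurable_finset_filter {Ω ι : Type*} [MeasurableSpace Ω] [Fintype ι]
    {p : Ω → ι → Prop} (hp : ∀ i, MeasurableSet {x | p x i}) :
    Measurable[_, ⊤] fun x => Finset.univ.filter (p x) := by
  let _ : MeasurableSpace (Finset ι) := ⊤
  refine measurable_to_countable' fun S => ?_
  have : (fun x => Finset.univ.filter (p x)) ⁻¹' {S} = ⋂ i, {x | p x i ↔ i ∈ S} := by
    ext x
    simp [Finset.ext_iff]
  rw [this]
  exact MeasurableSet.iInter fun i => (hp i).iff (MeasurableSet.const _)

theorem State.measurable_passing (τ : TieBreak A W) (α ε : ℝ) (k : ℕ) :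
    Measurable[_, ⊤] fun s : State A W => s.passing τ α ε k := by
  have key := measurable_finset_filter (Ω := State A W) (ι := Fin W)
    (p := fun s w => s.lcb α k (some w) (s.lowerArm τ α k w) ≤
      s.ucb α k none (s.lowerArm τ α k w) + ε ∧
        (k : ℝ) / 2 < s.count (some w) (s.lowerArm τ α k w)) fun w => ?_
  · convert key
    unfold State.passing
    congr!
  · have h := State.measurable_lowerArm (A := A) τ α k w
    have h1 : Measurable fun s : State A W => s.lcb α k (some w) (s.lowerArm τ α k w) :=
      measurable_apply_fin h fun i => measurable_pi_iff.1 (State.measurable_lcb α k (some w)) i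
    have h2 : Measurable fun s : State A W => s.ucb α k none (s.lowerArm τ α k w) :=
      measurable_apply_fin h fun i => measurable_pi_iff.1 (State.measurable_ucb α k none) i
    have h3 : Measurable fun s : State A W => (s.count (some w) (s.lowerArm τ α k w) : ℝ) :=
      measurable_apply_fin (F := fun s i => (s.count (some w) i : ℝ)) h fun i =>
        (Measurable.of_discrete (f := fun n : ℕ => (n : ℝ))).comp
          (State.measurable_count (some w) i)
    exact (measurableSet_le h1 (h2.add_const ε)).inter (measurableSet_lt measurable_const h3)

theorem State.measurable_leaders :
    Measurable[_, ⊤] fun s : State A W => Finset.univ.filter fun w : Fin W =>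
      ∃ a, s.prevArm = some a ∧ ∀ j, s.count (some w) j ≤ s.count (some w) a := by
  have key := measurable_finset_filter (Ω := State A W) (ι := Fin W)
    (p := fun s w => ∃ a, s.prevArm = some a ∧ ∀ j, s.count (some w) j ≤ s.count (some w) a)
    fun w => ?_
  · convert key
  · have h1 (a : Fin A) : MeasurableSet {s : State A W | s.prevArm = some a} :=
      measurableSet_setOfPred.2 (State.measurable_prev fun _ b => b = some a)
    have h2 (a j : Fin A) :
        MeasurableSet {s : State A W | s.count (some w) j ≤ s.count (some w) a} :=
      measurableSet_le (State.measurable_count _ _) (State.measurable_count _ _)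
    simp only [Set.ofPred_exists, Set.ofPred_and, Set.ofPred_forall]
    exact MeasurableSet.iUnion fun a => (h1 a).inter (MeasurableSet.iInter (h2 a))

/-- `State.select` as a function of finite data. -/
def selectFrom (τ : TieBreak A W) (k : ℕ) (I L : Finset (Fin W)) (prev : Option (Fin W))
    (draw : Cand W → Fin W) : Option (Fin W) :=
  if hI : I.Nonempty then
    match prev with
    | none => some (draw ⟨I, hI⟩)
    | some v =>
      if v ∈ I then some v
      else if hJ : (I.filter fun w => w ∈ L).Nonempty then
        some (τ.inherit k ⟨I.filter fun w => w ∈ L, hJ⟩)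
      else some (draw ⟨I, hI⟩)
  else none

theorem State.select_eq_selectFrom (s : State A W) (τ : TieBreak A W) (α ε : ℝ) (k : ℕ)
    (draw : Cand W → Fin W) :
    s.select τ α ε k draw = selectFrom τ k (s.passing τ α ε k)
      (Finset.univ.filter fun w : Fin W =>
        ∃ a, s.prevArm = some a ∧ ∀ j, s.count (some w) j ≤ s.count (some w) a)
      s.prevTask draw := by
  have : s.inheriting τ α ε k = (s.passing τ α ε k).filter fun w => w ∈
      Finset.univ.filter fun w : Fin W =>
        ∃ a, s.prevArm = some a ∧ ∀ j, s.count (some w) j ≤ s.count (some w) a := by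
    ext w
    simp [State.mem_inheriting]
  unfold State.select selectFrom
  simp only [this]

/-- The selection depends on the state only through finite discrete data, on which every function is
measurable; only the passing and leader sets need work. -/
theorem measurable_select (τ : TieBreak A W) (α ε : ℝ) (k : ℕ) :
    Measurable[_, ⊤] fun p : State A W × Noise A W => p.1.select τ α ε k p.2.2 := by
  let _ : MeasurableSpace (Option (Fin W)) := ⊤
  let _ : MeasurableSpace (Finset (Fin W)) := ⊤
  simp only [State.select_eq_selectFrom]
  have h0 : Measurable fun p : State A W × Noise A W => p.1 := measurable_fst
  have h1 := (State.measurable_passing (A := A) (W := W) τ α ε k).comp h0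
  have h2 := (State.measurable_leaders (A := A) (W := W)).comp h0
  have h3 := (State.measurable_prev (A := A) (W := W) fun t _ => t).comp h0
  have h4 : Measurable fun p : State A W × Noise A W => p.2.2 := measurable_snd.comp measurable_snd
  exact (Measurable.of_discrete (f := fun q : (Finset (Fin W) × Finset (Fin W)) ×
    (Option (Fin W) × (Cand W → Fin W)) => selectFrom τ k q.1.1 q.1.2 q.2.1 q.2.2)).comp
      ((h1.prodMk h2).prodMk (h3.prodMk h4))

theorem measurable_decide (τ : TieBreak A W) (α ε : ℝ) (k : ℕ) :
    Measurable fun p : State A W × Noise A W => p.1.decide τ α ε k p.2 := by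
  unfold State.decide
  split_ifs with h
  · exact measurable_const
  let _ : MeasurableSpace (Option (Fin W)) := ⊤
  have h1 := measurable_select (A := A) (W := W) τ α ε k
  have h2 : Measurable fun p : State A W × Noise A W => fun m => p.1.upperArm τ α k m :=
    measurable_pi_lambda _ fun m => (State.measurable_upperArm τ α k m).comp measurable_fst
  have h3 : Measurable fun p : State A W × Noise A W => fun w => p.1.lowerArm τ α k w :=
    measurable_pi_lambda _ fun w => (State.measurable_lowerArm τ α k w).comp measurable_fst
  exact (Measurable.of_discrete (f := fun q : Option (Fin W) ×
    ((Option (Fin W) → Fin A) × (Fin W → Fin A)) =>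
      ({ trusted := q.1
         arm := fun m =>
          match m with
          | some w => q.2.1 (some w)
          | none =>
            match q.1 with
            | none => q.2.1 none
            | some w => q.2.2 w } : Decision A W))).comp (h1.prodMk (h2.prodMk h3))

theorem measurable_step (τ : TieBreak A W) (α ε : ℝ) (k : ℕ) :
    Measurable fun p : State A W × Noise A W => p.1.step τ α ε k p.2 := by
  let _ : MeasurableSpace (Option (Fin W)) := ⊤
  let _ : MeasurableSpace (Option (Fin A)) := ⊤
  have hd := measurable_decide (A := A) (W := W) τ α ε k
  have harm (m : Option (Fin W)) (i : Fin A) :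
      MeasurableSet {p : State A W × Noise A W | (p.1.decide τ α ε k p.2).arm m = i} :=
    hd (show MeasurableSet {d : Decision A W | d.arm m = i} from trivial)
  refine measurable_comap_iff.2 ((Measurable.prodMk ?_ ?_).prodMk (Measurable.prodMk ?_ ?_))
  · refine measurable_pi_lambda _ fun m => measurable_pi_lambda _ fun i => ?_
    exact ((State.measurable_count m i).comp measurable_fst).add
      (Measurable.ite (harm m i) measurable_const measurable_const)
  · refine measurable_pi_lambda _ fun m => measurable_pi_lambda _ fun i => ?_
    refine ((State.measurable_total m i).comp measurable_fst).add
      (Measurable.ite (harm m i) ?_ measurable_const)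
    exact (measurable_pi_apply i).comp ((measurable_pi_apply m).comp
      (measurable_fst.comp measurable_snd))
  · exact (show Measurable fun d : Decision A W => d.trusted from fun _ _ => trivial).comp hd
  · exact (show Measurable fun d : Decision A W => some (d.arm none) from
      fun _ _ => trivial).comp hd

end

theorem measurable_stateAfter (τ : TieBreak A W) (α ε : ℝ) (n : ℕ) :
    Measurable fun ω : ℕ → Noise A W => stateAfter τ α ε ω n := by
  induction n with
  | zero => exact measurable_const
  | succ n ih =>
    exact (measurable_step τ α ε (n + 1)).comp (ih.prodMk (measurable_pi_apply (n + 1)))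

/-! ### Concentration -/

theorem stateAfter_congr (τ : TieBreak A W) (α ε : ℝ) {ω ω' : ℕ → Noise A W} {n : ℕ}
    (h : ∀ l ≤ n, ω l = ω' l) : stateAfter τ α ε ω n = stateAfter τ α ε ω' n := by
  induction n with
  | zero => rfl
  | succ n ih =>
    rw [stateAfter, stateAfter, ih fun l hl => h l (by omega), h _ le_rfl]

/-- The state after `n` iterations is a function of the coordinates up to `n`, which are independent
of the next one. -/
theorem indepFun_stateAfter (M : Problem A W) (τ : TieBreak A W) (α ε : ℝ) (n : ℕ) :
    IndepFun (fun ω => stateAfter τ α ε ω n) (fun ω => ω (n + 1)) M.P := by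
  have hind : iIndepFun (fun (l : ℕ) (ω : ℕ → Noise A W) => ω l) M.P :=
    iIndepFun_infinitePi (P := fun _ : ℕ => M.noiseLaw) (X := fun _ x => x)
      fun _ => measurable_id
  have h := hind.indepFun_finset (Finset.range (n + 1)) {n + 1} (by simp)
    fun l => measurable_pi_apply l
  -- An arbitrary filler for the coordinates beyond `n`; by `stateAfter_congr` its value is
  -- immaterial.
  let x₀ : Noise A W := (fun _ _ => 0, fun S => S.2.choose)
  let ext : (Finset.range (n + 1) → Noise A W) → ℕ → Noise A W := fun r l =>
    if hl : l ∈ Finset.range (n + 1) then r ⟨l, hl⟩ else x₀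
  have hext : Measurable ext := by
    refine measurable_pi_lambda _ fun l => ?_
    by_cases hl : l ∈ Finset.range (n + 1)
    · simp only [ext, dif_pos hl]
      exact measurable_pi_apply _
    · simp only [ext, dif_neg hl]
      exact measurable_const
  have h' := h.comp ((measurable_stateAfter τ α ε n).comp hext)
    (measurable_pi_apply (⟨n + 1, Finset.mem_singleton_self _⟩ : ({n + 1} : Finset ℕ)))
  refine h'.congr (.of_forall fun ω => ?_) (.of_forall fun ω => rfl)
  exact stateAfter_congr τ α ε fun l hl => dif_pos (Finset.mem_range.2 (Nat.lt_succ_of_le hl))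

theorem map_stateAfter_prod (M : Problem A W) (τ : TieBreak A W) (α ε : ℝ) (n : ℕ) :
    M.P.map (fun ω => (stateAfter τ α ε ω n, ω (n + 1))) =
      (M.P.map fun ω => stateAfter τ α ε ω n).prod M.noiseLaw := by
  rw [(indepFun_stateAfter M τ α ε n).map_prod_eq_prod_map_map
    (measurable_stateAfter τ α ε n).aemeasurable (measurable_pi_apply _).aemeasurable]
  congr 1
  exact Measure.infinitePi_map_eval (fun _ : ℕ => M.noiseLaw) (n + 1)

/-- Hoeffding's lemma: a variable with values in an interval of length one is sub-Gaussian with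
variance proxy `1/4`, hence `t²/8`. -/
theorem Bandit.lintegral_exp_le_one (B : Bandit A) (i : Fin A) (t : ℝ) :
    ∫⁻ x, ENNReal.ofReal (Real.exp (t * (x - B.mean i) - t ^ 2 / 8)) ∂(B.law i) ≤ 1 := by
  have hsub := hasSubgaussianMGF_of_mem_Icc (X := fun x : ℝ => x) aemeasurable_id (B.bounded i)
  have hmgf := hsub.mgf_le t
  have hint := hsub.integrable_exp_mul t
  have heq : ∀ x : ℝ, Real.exp (t * (x - B.mean i) - t ^ 2 / 8) =
      Real.exp (-(t ^ 2 / 8)) * Real.exp (t * (x - ∫ y, y ∂(B.law i))) := fun x => by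
    rw [← Real.exp_add, Bandit.mean]; ring_nf
  simp_rw [heq]
  rw [← ofReal_integral_eq_lintegral_ofReal (hint.const_mul _)
    (Filter.Eventually.of_forall fun x => by positivity), integral_const_mul]
  refine ENNReal.ofReal_le_one.2 ?_
  calc _ ≤ Real.exp (-(t ^ 2 / 8)) * Real.exp (t ^ 2 / 8) := by
        gcongr
        refine hmgf.trans (le_of_eq ?_)
        congr 1
        norm_num
        ring
    _ = 1 := by rw [← Real.exp_add]; simp

/-- The exponential supermartingale of the rewards of arm `i` in task `m`. -/
def State.expWeight (s : State A W) (M : Problem A W) (m : Option (Fin W)) (i : Fin A)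
    (t : ℝ) : ENNReal :=
  ENNReal.ofReal (Real.exp (t * (s.total m i - (M.task m).mean i * s.count m i) -
    t ^ 2 / 8 * s.count m i))

theorem State.measurable_expWeight (M : Problem A W) (m : Option (Fin W)) (i : Fin A) (t : ℝ) :
    Measurable fun s : State A W => s.expWeight M m i t := by
  have h1 := State.measurable_total (A := A) m i
  have h2 : Measurable fun s : State A W => (s.count m i : ℝ) :=
    (Measurable.of_discrete (f := fun n : ℕ => (n : ℝ))).comp (State.measurable_count m i)
  unfold State.expWeight
  fun_prop

theorem State.expWeight_step (s : State A W) (M : Problem A W) (τ : TieBreak A W) (α ε : ℝ)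
    (k : ℕ) (x : Noise A W) (m : Option (Fin W)) (i : Fin A) (t : ℝ) :
    (s.step τ α ε k x).expWeight M m i t = s.expWeight M m i t *
      if (s.decide τ α ε k x).arm m = i then
        ENNReal.ofReal (Real.exp (t * (x.1 m i - (M.task m).mean i) - t ^ 2 / 8)) else 1 := by
  unfold State.expWeight State.step
  split_ifs with h
  · rw [← ENNReal.ofReal_mul (Real.exp_nonneg _), ← Real.exp_add]
    congr 2
    simp only [h, if_true]
    push_cast
    ring
  · simp [h]

theorem State.lintegral_expWeight_step_le (s : State A W) (M : Problem A W) (τ : TieBreak A W)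
    (α ε : ℝ) (k : ℕ) (m : Option (Fin W)) (i : Fin A) (t : ℝ) :
    ∫⁻ x, (s.step τ α ε k x).expWeight M m i t ∂M.noiseLaw ≤ s.expWeight M m i t := by
  have hmeas : Measurable fun x : Noise A W => (s.step τ α ε k x).expWeight M m i t :=
    (State.measurable_expWeight M m i t).comp
      ((measurable_step τ α ε k).comp measurable_prodMk_left)
  unfold Problem.noiseLaw
  -- The arm pulled may depend on the draw but not on the current rewards, so the rewards are
  -- integrated first with the draw fixed.
  rw [lintegral_prod_symm' _ hmeas]
  refine (lintegral_mono (g := fun _ => s.expWeight M m i t) fun d => ?_).trans (by simp)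
  simp only [State.expWeight_step]
  rw [lintegral_const_mul']
  swap
  · exact ENNReal.ofReal_ne_top
  refine mul_le_of_le_one_right' ?_
  by_cases h : (s.decide τ α ε k (fun _ _ => 0, d)).arm m = i
  · have h' : ∀ r, (s.decide τ α ε k (r, d)).arm m = i := fun r => h
    simp only [h', if_true]
    have hmp : MeasurePreserving (fun r : Option (Fin W) → Fin A → ℝ => r m i)
        (Measure.pi fun m => Measure.pi fun i => (M.task m).law i) ((M.task m).law i) :=
      (measurePreserving_eval (fun i => (M.task m).law i) i).comp
        (measurePreserving_eval (fun m => Measure.pi fun i => (M.task m).law i) m)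
    rw [hmp.lintegral_comp (f := fun y => ENNReal.ofReal
      (Real.exp (t * (y - (M.task m).mean i) - t ^ 2 / 8))) (by fun_prop)]
    exact (M.task m).lintegral_exp_le_one i t
  · have h' : ∀ r, ¬ (s.decide τ α ε k (r, d)).arm m = i := fun r => h
    simp [h']

theorem lintegral_expWeight_le_one (M : Problem A W) (τ : TieBreak A W) (α ε : ℝ) (n : ℕ)
    (m : Option (Fin W)) (i : Fin A) (t : ℝ) :
    ∫⁻ ω, (stateAfter τ α ε ω n).expWeight M m i t ∂M.P ≤ 1 := by
  induction n with
  | zero => simp [stateAfter, State.initial, State.expWeight]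
  | succ n ih =>
    refine le_trans ?_ ih
    have hm : Measurable fun p : State A W × Noise A W =>
        (p.1.step τ α ε (n + 1) p.2).expWeight M m i t :=
      (State.measurable_expWeight M m i t).comp (measurable_step τ α ε (n + 1))
    calc ∫⁻ ω, (stateAfter τ α ε ω (n + 1)).expWeight M m i t ∂M.P
        = ∫⁻ p, (p.1.step τ α ε (n + 1) p.2).expWeight M m i t
            ∂(M.P.map fun ω => (stateAfter τ α ε ω n, ω (n + 1))) := by
          rw [lintegral_map hm
            ((measurable_stateAfter τ α ε n).prodMk (measurable_pi_apply _))]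
          rfl
      _ = ∫⁻ s, ∫⁻ x, (s.step τ α ε (n + 1) x).expWeight M m i t ∂M.noiseLaw
            ∂(M.P.map fun ω => stateAfter τ α ε ω n) := by
          rw [map_stateAfter_prod, lintegral_prod _ hm.aemeasurable]
      _ ≤ ∫⁻ s, s.expWeight M m i t ∂(M.P.map fun ω => stateAfter τ α ε ω n) :=
          lintegral_mono fun s => s.lintegral_expWeight_step_le M τ α ε (n + 1) m i t
      _ = ∫⁻ ω, (stateAfter τ α ε ω n).expWeight M m i t ∂M.P :=
          lintegral_map (State.measurable_expWeight M m i t) (measurable_stateAfter τ α ε n)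

/-- Chernoff's bound: Markov's inequality for the exponential weight. -/
theorem measureReal_le_exp_neg (M : Problem A W) (τ : TieBreak A W) (α ε : ℝ) (n : ℕ)
    (m : Option (Fin W)) (i : Fin A) (t v : ℝ) :
    M.P.real {ω | v ≤ t * ((stateAfter τ α ε ω n).total m i -
      (M.task m).mean i * (stateAfter τ α ε ω n).count m i) -
        t ^ 2 / 8 * (stateAfter τ α ε ω n).count m i} ≤ Real.exp (-v) := by
  have hm : Measurable fun ω : ℕ → Noise A W => (stateAfter τ α ε ω n).expWeight M m i t :=
    (State.measurable_expWeight M m i t).comp (measurable_stateAfter τ α ε n)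
  have h1 := (mul_meas_ge_le_lintegral hm (μ := M.P) (ENNReal.ofReal (Real.exp v))).trans
    (lintegral_expWeight_le_one M τ α ε n m i t)
  refine ENNReal.toReal_le_of_le_ofReal (Real.exp_nonneg _) ?_
  rw [Real.exp_neg, ENNReal.ofReal_inv_of_pos (Real.exp_pos v)]
  refine ENNReal.le_inv_iff_mul_le.2 (le_trans (le_of_eq ?_) h1)
  rw [mul_comm]
  congr 2
  ext ω
  simp only [Set.mem_ofPred_eq, State.expWeight]
  rw [ENNReal.ofReal_le_ofReal_iff (Real.exp_nonneg _), Real.exp_le_exp]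

theorem measureReal_count_eq_and_width_lt_le (M : Problem A W) (τ : TieBreak A W) {α : ℝ} (ε : ℝ)
    (hα : 0 ≤ α) (n k : ℕ) (m : Option (Fin W)) (i : Fin A) {c : ℕ} (hc : 0 < c) :
    M.P.real {ω | (stateAfter τ α ε ω n).count m i = c ∧
      (stateAfter τ α ε ω n).width α k m i <
        |(stateAfter τ α ε ω n).empMean m i - (M.task m).mean i|} ≤
      2 * confLevel A W k ^ (-(4 * α)) := by
  have hc' : (0 : ℝ) < c := by exact_mod_cast hc
  have hf : 0 < confLevel A W k := one_pos.trans_le (one_le_confLevel A W k)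
  have hlog := log_confLevel_nonneg A W k
  set w : ℝ := √(2 * α * Real.log (confLevel A W k) / c) with hw
  have hw2 : w ^ 2 * c = 2 * α * Real.log (confLevel A W k) := by
    rw [hw, Real.sq_sqrt (by positivity)]
    field_simp
  have hexp : confLevel A W k ^ (-(4 * α)) =
      Real.exp (-(4 * α * Real.log (confLevel A W k))) := by
    rw [Real.rpow_def_of_pos hf]; ring_nf
  -- Fixing the count `c` makes the optimal slope deterministic: a deviation `w` per pull gives the
  -- exponent `t w c - t² c / 8`, maximal at `t = 4w` with value `2w²c = 4α log f`.
  have h1 := measureReal_le_exp_neg M τ α ε n m i (4 * w) (4 * α * Real.log (confLevel A W k))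
  have h2 := measureReal_le_exp_neg M τ α ε n m i (-(4 * w))
    (4 * α * Real.log (confLevel A W k))
  rw [hexp, two_mul]
  refine le_trans (le_trans (measureReal_mono ?_) (measureReal_union_le _ _)) (add_le_add h1 h2)
  rintro ω ⟨hcount, hlt⟩
  have hw0 : 0 ≤ w := Real.sqrt_nonneg _
  rw [State.width, State.empMean, hcount, ← hw] at hlt
  simp only [Set.mem_union, Set.mem_ofPred_eq, hcount]
  set S := (stateAfter τ α ε ω n).total m i
  set μ := (M.task m).mean i
  have hS : S - μ * c = (S / c - μ) * c := by field_simp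
  rw [hS]
  rcases lt_abs.1 hlt with h | h
  · left
    have := mul_le_mul_of_nonneg_left (mul_le_mul_of_nonneg_right h.le hc'.le)
      (by positivity : 0 ≤ 4 * w)
    nlinarith
  · right
    have := mul_le_mul_of_nonneg_left (mul_le_mul_of_nonneg_right h.le hc'.le)
      (by positivity : 0 ≤ 4 * w)
    nlinarith

theorem measureReal_not_accurate_le (M : Problem A W) (τ : TieBreak A W) {α : ℝ} (ε : ℝ)
    (hα : 0 ≤ α) {n : ℕ} (hn : A ≤ n) (k : ℕ) :
    M.P.real {ω | ¬ (stateAfter τ α ε ω n).Accurate M α k} ≤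
      (W + 1) * (A * (n * (2 * confLevel A W k ^ (-(4 * α))))) := by
  let S (m : Option (Fin W)) (i : Fin A) (c : ℕ) : Set (ℕ → Noise A W) :=
    {ω | (stateAfter τ α ε ω n).count m i = c ∧ (stateAfter τ α ε ω n).width α k m i <
        |(stateAfter τ α ε ω n).empMean m i - (M.task m).mean i|}
  have hsub : {ω | ¬ (stateAfter τ α ε ω n).Accurate M α k} ⊆
      ⋃ m, ⋃ i, ⋃ c ∈ Finset.Icc 1 n, S m i c := by
    intro ω hω
    simp only [State.Accurate, not_forall, not_le, Set.mem_ofPred_eq] at hω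
    obtain ⟨m, i, h⟩ := hω
    simp only [Set.mem_iUnion]
    exact ⟨m, i, _, Finset.mem_Icc.2 ⟨one_le_count τ α ε ω hn m i, count_le τ α ε ω n m i⟩,
      rfl, h⟩
  calc _ ≤ _ := measureReal_mono hsub
    _ ≤ ∑ m : Option (Fin W), ∑ i : Fin A, ∑ c ∈ Finset.Icc 1 n, M.P.real (S m i c) :=
      (measureReal_iUnion_fintype_le _).trans <| Finset.sum_le_sum fun m _ =>
        (measureReal_iUnion_fintype_le _).trans <| Finset.sum_le_sum fun i _ =>
          measureReal_biUnion_finset_le _ _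
    _ ≤ ∑ m : Option (Fin W), ∑ i : Fin A, ∑ c ∈ Finset.Icc 1 n,
        2 * confLevel A W k ^ (-(4 * α)) :=
      Finset.sum_le_sum fun m _ => Finset.sum_le_sum fun i _ => Finset.sum_le_sum fun c hc =>
        measureReal_count_eq_and_width_lt_le M τ ε hα n k m i (Finset.mem_Icc.1 hc).1
    _ = _ := by simp

theorem ae_draw_mem (M : Problem A W) : ∀ᵐ ω ∂M.P, ∀ n S, (ω n).2 S ∈ S.1 := by
  rw [ae_all_iff]
  intro n
  rw [ae_all_iff]
  intro S
  have h1 : MeasurePreserving (fun ω : ℕ → Noise A W => ω n) M.P M.noiseLaw :=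
    measurePreserving_eval_infinitePi (fun _ : ℕ => M.noiseLaw) n
  have h2 : MeasurePreserving (fun ω : ℕ → Noise A W => (ω n).2 S) M.P
      (PMF.uniformOfFinset S.1 S.2).toMeasure :=
    (measurePreserving_eval
      (fun S : Cand W => (PMF.uniformOfFinset S.1 S.2).toMeasure) S).comp
        (measurePreserving_snd.comp h1)
  refine h2.quasiMeasurePreserving.ae (p := fun w => w ∈ S.1) ?_
  rw [ae_iff, PMF.toMeasure_apply_eq_zero_iff _ (Set.Finite.measurableSet (Set.toFinite _))]
  rw [PMF.support_uniformOfFinset]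
  exact Set.disjoint_left.2 fun w hw hw' => hw' hw

/-! ### The time after which the high-tier task has found its optimal arm -/

theorem log_four_ge_one : 1 ≤ Real.log 4 := by
  rw [Real.le_log_iff_exp_le (by norm_num)]
  linarith [Real.exp_one_lt_d9]

/-- Solves the implicit inequality in `k`: with `B = αA/Δ²`, the term `A L / 2` equals `B log f(k)`,
and the `log k` hidden in it is traded for a small multiple of `k`. -/
theorem mul_pullScale_le {α Δ : ℝ} {k : ℕ} (hA : 2 ≤ A) (hW : 1 ≤ W) (hα : 2 < α) (hΔ : 0 < Δ)
    (hΔ1 : Δ ≤ 1)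
    (hk : 204800 * (α * A / Δ ^ 2) * Real.log (α * A * W / Δ) ≤ (k + 1 : ℕ)) :
    4096 * (A + A * (pullScale A W α Δ k / 2)) ≤ (k + 1 : ℕ) := by
  have hA' : (2 : ℝ) ≤ A := by exact_mod_cast hA
  have hW' : (1 : ℝ) ≤ W := by exact_mod_cast hW
  set x : ℝ := ((k + 1 : ℕ) : ℝ) with hx
  have hx1 : 1 ≤ x := by rw [hx]; push_cast; linarith [(Nat.cast_nonneg k : (0 : ℝ) ≤ k)]
  set B : ℝ := α * A / Δ ^ 2 with hB
  set X : ℝ := α * A * W / Δ with hX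
  set l : ℝ := Real.log X with hl
  have hAX : A * W ≤ X := by
    rw [hX, le_div_iff₀ hΔ]
    nlinarith [mul_pos (by linarith : (0 : ℝ) < A) (by linarith : (0 : ℝ) < W)]
  have hX4 : 4 ≤ X := by
    rw [hX, le_div_iff₀ hΔ]
    nlinarith [mul_le_mul hA' hW' zero_le_one (by linarith : (0 : ℝ) ≤ A),
      mul_pos (by linarith : (0 : ℝ) < A) (by linarith : (0 : ℝ) < W)]
  have hl4 : Real.log 4 ≤ l := Real.log_le_log (by norm_num) hX4
  have hl1 : 1 ≤ l := log_four_ge_one.trans hl4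
  have hBA : (A : ℝ) ≤ B := by
    rw [hB, le_div_iff₀ (by positivity)]
    have : Δ ^ 2 ≤ 1 := pow_le_one₀ hΔ.le hΔ1
    nlinarith
  have hB0 : 0 < B := by linarith
  have hBX : B ≤ X ^ 2 := by
    rw [hB, hX, div_pow]
    gcongr
    have h1 : 1 ≤ α * A := by nlinarith
    have h2 : (1 : ℝ) ≤ W ^ 2 := one_le_pow₀ hW'
    rw [mul_pow]
    nlinarith [mul_le_mul (by nlinarith : α * A ≤ (α * A) ^ 2) h2 zero_le_one (sq_nonneg (α * A))]
  have hf : confLevel A W (k + 1) ≤ X ^ 6 * x ^ 2 := by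
    unfold confLevel
    rw [← hx]
    have h1 : (W : ℝ) * A ^ 2 ≤ X ^ 2 := by
      calc (W : ℝ) * A ^ 2 ≤ W ^ 2 * A ^ 2 := by
            gcongr
            nlinarith
        _ = ((A : ℝ) * W) ^ 2 := by ring
        _ ≤ X ^ 2 := by gcongr
    have h2 : (x + 1) ^ 2 ≤ 4 * x ^ 2 := by nlinarith
    have h3 : (1 : ℝ) ≤ X ^ 2 * x ^ 2 :=
      one_le_mul_of_one_le_of_one_le (one_le_pow₀ (by linarith)) (one_le_pow₀ hx1)
    calc 1 + 16 * W * (A : ℝ) ^ 2 * (x + 1) ^ 2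
        = 1 + 16 * (W * (A : ℝ) ^ 2) * (x + 1) ^ 2 := by ring
      _ ≤ X ^ 2 * x ^ 2 + 16 * X ^ 2 * (4 * x ^ 2) := by gcongr
      _ = 65 * (X ^ 2 * x ^ 2) := by ring
      _ ≤ X ^ 4 * (X ^ 2 * x ^ 2) := by
          gcongr
          calc (65 : ℝ) ≤ 4 ^ 4 := by norm_num
            _ ≤ X ^ 4 := by gcongr
      _ = X ^ 6 * x ^ 2 := by ring
  have hX0 : 0 < X := by linarith
  have hlogf : Real.log (confLevel A W (k + 1)) ≤ 6 * l + 2 * Real.log x := by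
    refine (Real.log_le_log (by linarith [one_le_confLevel A W (k + 1)]) hf).trans (le_of_eq ?_)
    rw [Real.log_mul (by positivity) (by positivity), Real.log_pow, Real.log_pow, ← hl]
    norm_num
  have hlogx : Real.log x ≤ 9 * l + x / (16384 * B) := by
    -- The tangent bound `log y ≤ y - 1` at `y = x / (16384 B)`. The divisor is chosen so that,
    -- after multiplication by `2 · 4096 · B`, the linear term is `x/2`.
    have h1 := Real.log_le_sub_one_of_pos (show 0 < x / (16384 * B) by positivity)
    rw [Real.log_div (by positivity) (by positivity), Real.log_mul (by norm_num) hB0.ne'] at h1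
    have h2 : Real.log 16384 ≤ 7 * l := by
      rw [show (16384 : ℝ) = 4 ^ 7 by norm_num, Real.log_pow]
      push_cast
      linarith
    have h3 : Real.log B ≤ 2 * l := by
      refine (Real.log_le_log hB0 hBX).trans (le_of_eq ?_)
      rw [Real.log_pow, ← hl]
      norm_num
    linarith
  have hL : A * (pullScale A W α Δ k / 2) = B * Real.log (confLevel A W (k + 1)) := by
    unfold pullScale
    rw [hB]
    ring
  have h5 : B * Real.log (confLevel A W (k + 1)) ≤ 24 * (B * l) + x / 8192 := by
    calc B * Real.log (confLevel A W (k + 1))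
        ≤ B * (6 * l + 2 * (9 * l + x / (16384 * B))) := by
          gcongr
          linarith
      _ = 24 * (B * l) + x / 8192 := by
          field_simp
          ring
  have h6 : (A : ℝ) ≤ B * l := hBA.trans (le_mul_of_one_le_right hB0.le hl1)
  rw [hL]
  -- The left side is at most `4096 · 25 · B l + x/2`, and `204800 = 2 · 4096 · 25`.
  linarith

/-- In the window `f` is at least `W k`, since `A² ≥ 4` and `k² / 4 ≥ k`. Most of the resulting
power is discarded: one factor `1/W` is kept for the union over tasks. -/
theorem rpow_confLevel_le {α : ℝ} {n k : ℕ} (hA : 2 ≤ A) (hW : 1 ≤ W) (hα : 2 < α) (hk : 4 ≤ k)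
    (hn : (k : ℝ) ≤ 16 * (n + 1)) :
    confLevel A W (n + 1) ^ (-(4 * α)) ≤ (W : ℝ)⁻¹ * (k : ℝ) ^ (-(2 * α)) := by
  have hA' : (2 : ℝ) ≤ A := by exact_mod_cast hA
  have hW' : (1 : ℝ) ≤ W := by exact_mod_cast hW
  have hk' : (4 : ℝ) ≤ k := by exact_mod_cast hk
  have hn0 : (0 : ℝ) ≤ n := Nat.cast_nonneg n
  have h1 : (W : ℝ) * k ≤ confLevel A W (n + 1) := by
    unfold confLevel
    push_cast
    have h2 : (4 : ℝ) ≤ A ^ 2 := by nlinarith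
    have h3 : (k : ℝ) / 16 ≤ n + 1 + 1 := by linarith
    have h4 : ((k : ℝ) / 16) ^ 2 ≤ ((n : ℝ) + 1 + 1) ^ 2 := by gcongr
    calc (W : ℝ) * k ≤ 16 * W * 4 * ((k : ℝ) / 16) ^ 2 := by
          have h5 : (k : ℝ) ≤ k * k / 4 := by nlinarith
          have h6 := mul_le_mul_of_nonneg_left h5 (by linarith : (0 : ℝ) ≤ W)
          linarith
      _ ≤ 16 * W * A ^ 2 * ((n : ℝ) + 1 + 1) ^ 2 := by gcongr
      _ ≤ _ := by linarith
  calc confLevel A W (n + 1) ^ (-(4 * α)) ≤ ((W : ℝ) * k) ^ (-(4 * α)) :=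
        Real.rpow_le_rpow_of_nonpos (by positivity) h1 (by linarith)
    _ = (W : ℝ) ^ (-(4 * α)) * (k : ℝ) ^ (-(4 * α)) :=
        Real.mul_rpow (by positivity) (by positivity)
    _ ≤ (W : ℝ) ^ (-1 : ℝ) * (k : ℝ) ^ (-(2 * α)) := by
        gcongr <;> linarith
    _ = _ := by rw [Real.rpow_neg_one]

theorem armAt_eq_of_accurate {M : Problem A W} {τ : TieBreak A W} {α ε Δ : ℝ}
    {ω : ℕ → Noise A W} {opt : Option (Fin W) → Fin A} {k : ℕ}
    (hsep : M.Separated opt Δ) (hΔ : 0 < Δ) (hα : 0 ≤ α) (hε : ε ≤ Δ / 4)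
    (hdom : ∀ w, M.hi.mean (opt none) - Δ / 2 ≤ (M.lo w).mean (opt (some w)))
    (hclose : ∃ w, opt (some w) = opt none ∧
      (M.lo w).mean (opt none) ≤ M.hi.mean (opt none) + ε)
    (hA : 2 ≤ A)
    (hlarge : 4096 * (A + A * (pullScale A W α Δ k / 2)) ≤ (k + 1 : ℕ))
    (hdraw : ∀ n S, (ω n).2 S ∈ S.1)
    (hacc : ∀ n, (k + 1) / 16 ≤ n → n ≤ k → (stateAfter τ α ε ω n).Accurate M α (n + 1)) :
    armAt τ α ε ω k none = opt none := by
  have hA' : (2 : ℝ) ≤ A := by exact_mod_cast hA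
  have hL := pullScale_nonneg (A := A) (W := W) hα Δ k
  set L := pullScale A W α Δ k
  have hAL : L ≤ A * L := by nlinarith
  have ha1 : (((k + 1) / 16 : ℕ) : ℝ) ≤ ((k + 1 : ℕ) : ℝ) / 16 := by
    exact_mod_cast Nat.cast_div_le (α := ℝ) (m := k + 1) (n := 16)
  have hb1 : (((k + 1) / 2 : ℕ) : ℝ) ≤ ((k + 1 : ℕ) : ℝ) / 2 := by
    exact_mod_cast Nat.cast_div_le (α := ℝ) (m := k + 1) (n := 2)
  have hb2 : ((k + 1 : ℕ) : ℝ) / 2 ≤ (((k + 1) / 2 : ℕ) : ℝ) + 1 / 2 := by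
    have h : k + 1 ≤ 2 * ((k + 1) / 2) + 1 := by omega
    have h' : ((k + 1 : ℕ) : ℝ) ≤ 2 * (((k + 1) / 2 : ℕ) : ℝ) + 1 := by exact_mod_cast h
    linarith
  have harms : A ≤ (k + 1) / 16 := by
    rw [Nat.le_div_iff_mul_le (by norm_num)]
    have h : (A : ℝ) * 16 ≤ ((k + 1 : ℕ) : ℝ) := by nlinarith
    exact_mod_cast h
  have hfav : FavorableRun M τ α ε ω opt Δ ((k + 1) / 16) ((k + 1) / 2) k :=
    { separated := hsep
      gap_pos := hΔ
      alpha_nonneg := hα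
      eps_le := hε
      dominance := hdom
      close := hclose
      arms_le := harms
      le := by omega
      draw_mem := hdraw
      accurate := hacc
      half_lt := by linarith
      scale_le := by linarith }
  refine hfav.armAt_eq (by omega) ?_
  push_cast at *
  linarith

end TieredBandit

end

/-! ### Assembly: union bound over the window of iterations -/

theorem mainTheorem7 :
    ∃ cStar : ℝ, 0 < cStar ∧ ∃ C : ℝ, 0 < C ∧
      ∀ (A W : ℕ) (M : TieredBandit.Problem A W) (τ : TieredBandit.TieBreak A W)
        (Δt α : ℝ) (iHi : Fin A),
        M.UniqueOptimalArms →
        M.OptimalValueDominance →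
        0 < M.minGap →
        0 ≤ Δt → Δt ≤ M.minGap →
        2 < α →
        (∃ w, M.IsClose (Δt / 4) w) →
        M.hi.IsOptimalArm iHi →
        ∀ k : ℕ,
          cStar * (α * A / M.minGap ^ 2) * Real.log (α * A * W / M.minGap) ≤ (k : ℝ) →
          M.P.real {ω | TieredBandit.armHi τ α (Δt / 4) k ω ≠ iHi} ≤
            C * (A / (k : ℝ) ^ (2 * α - 2)) := by
  open TieredBandit in
  refine ⟨204800, by norm_num, 4, by norm_num, ?_⟩
  intro A W M τ Δt α iHi huniq hdom hgap _ hΔt hα hclose hiHi k hk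
  obtain ⟨opt, hopt, hsep⟩ := M.exists_separated huniq
  obtain ⟨w₀, hval, harm⟩ := hclose
  have hA := M.two_le_arms hgap
  have hW : 1 ≤ W := w₀.pos
  have hhi : M.hi.optValue = M.hi.mean (opt none) :=
    Bandit.IsOptimalArm.optValue_eq ((hopt none _).2 rfl)
  have hlo (w : Fin W) : (M.lo w).optValue = (M.lo w).mean (opt (some w)) :=
    Bandit.IsOptimalArm.optValue_eq ((hopt (some w) _).2 rfl)
  have hiHi' : iHi = opt none := (hopt none iHi).1 hiHi
  have hw₀ : opt (some w₀) = opt none :=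
    ((hopt (some w₀) _).1 ((harm _).1 ((hopt none _).2 rfl))).symm
  have hA' : (2 : ℝ) ≤ A := by exact_mod_cast hA
  have hW' : (1 : ℝ) ≤ W := by exact_mod_cast hW
  have hΔ1 := M.minGap_le_one hgap
  have hkpos : (0 : ℝ) < k := by
    refine lt_of_lt_of_le ?_ hk
    have : 1 < α * A * W / M.minGap := by
      rw [lt_div_iff₀ hgap]
      nlinarith [mul_le_mul hA' hW' zero_le_one (by linarith : (0 : ℝ) ≤ A)]
    have := Real.log_pos this
    positivity
  obtain ⟨N, rfl⟩ : ∃ N, k = N + 1 :=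
    ⟨k - 1, (Nat.succ_pred_eq_of_pos (by exact_mod_cast hkpos)).symm⟩
  have hlarge := mul_pullScale_le hA hW hα hgap hΔ1 hk
  have hk4 : 4 ≤ N + 1 := by
    have hL := pullScale_nonneg (A := A) (W := W) (α := α) (by linarith) M.minGap N
    have h0 : 0 ≤ (A : ℝ) * (pullScale A W α M.minGap N / 2) := by positivity
    have : (4 : ℝ) ≤ ((N + 1 : ℕ) : ℝ) := by linarith
    exact_mod_cast this
  -- The inclusion is only almost sure, because draws lie in their candidate sets only almost
  -- surely.
  have hsub : {ω | armHi τ α (Δt / 4) (N + 1) ω ≠ iHi} ≤ᵐ[M.P]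
      ⋃ n ∈ Finset.Icc ((N + 1) / 16) N,
        {ω | ¬ (stateAfter τ α (Δt / 4) ω n).Accurate M α (n + 1)} := by
    filter_upwards [ae_draw_mem M] with ω hdraw hω
    by_contra hcon
    have hcon' : ¬ ω ∈ ⋃ n ∈ Finset.Icc ((N + 1) / 16) N,
        {ω | ¬ (stateAfter τ α (Δt / 4) ω n).Accurate M α (n + 1)} := hcon
    simp only [Set.mem_iUnion, Set.mem_ofPred_eq, not_exists, not_not, Finset.mem_Icc] at hcon'
    refine hω ?_
    rw [hiHi']
    refine armAt_eq_of_accurate hsep hgap (by linarith) (by linarith) (fun w => ?_)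
      ⟨w₀, hw₀, ?_⟩ hA hlarge hdraw fun n h1 h2 => hcon' n ⟨h1, h2⟩
    · rw [← hhi, ← hlo]
      exact hdom w
    · rw [hlo, hhi, hw₀] at hval
      linarith
  have hterm : ∀ n ∈ Finset.Icc ((N + 1) / 16) N,
      M.P.real {ω | ¬ (stateAfter τ α (Δt / 4) ω n).Accurate M α (n + 1)} ≤
        4 * A * (((N + 1 : ℕ) : ℝ) * ((N + 1 : ℕ) : ℝ) ^ (-(2 * α))) := by
    intro n hn
    obtain ⟨hn1, hn2⟩ := Finset.mem_Icc.1 hn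
    have hAn : A ≤ n := by
      refine le_trans ?_ hn1
      rw [Nat.le_div_iff_mul_le (by norm_num)]
      have hL := pullScale_nonneg (A := A) (W := W) (α := α) (by linarith) M.minGap N
      have h0 : 0 ≤ (A : ℝ) * (pullScale A W α M.minGap N / 2) := by positivity
      have h : (A : ℝ) * 16 ≤ ((N + 1 : ℕ) : ℝ) := by linarith
      exact_mod_cast h
    have h1 : ((N + 1 : ℕ) : ℝ) ≤ 16 * (n + 1) := by
      have h : N + 1 ≤ 16 * (n + 1) := by omega
      exact_mod_cast h
    have h2 := rpow_confLevel_le hA hW hα hk4 h1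
    have h3 : (n : ℝ) ≤ ((N + 1 : ℕ) : ℝ) := by exact_mod_cast (by omega : n ≤ N + 1)
    have h4 : ((W : ℝ) + 1) * (W : ℝ)⁻¹ ≤ 2 := by
      rw [← div_eq_mul_inv, div_le_iff₀ (by linarith)]
      linarith
    refine (measureReal_not_accurate_le M τ (Δt / 4) (by linarith) hAn (n + 1)).trans ?_
    have h5 : 0 ≤ confLevel A W (n + 1) ^ (-(4 * α)) :=
      Real.rpow_nonneg (zero_le_one.trans (one_le_confLevel A W (n + 1))) _
    set x : ℝ := ((N + 1 : ℕ) : ℝ)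
    calc ((W : ℝ) + 1) * (A * (n * (2 * confLevel A W (n + 1) ^ (-(4 * α)))))
        ≤ (W + 1) * (A * (x * (2 * ((W : ℝ)⁻¹ * x ^ (-(2 * α)))))) := by gcongr
      _ = (W + 1) * (W : ℝ)⁻¹ * (2 * A * (x * x ^ (-(2 * α)))) := by ring
      _ ≤ 2 * (2 * A * (x * x ^ (-(2 * α)))) := by gcongr
      _ = _ := by ring
  have hcard : ((Finset.Icc ((N + 1) / 16) N).card : ℝ) ≤ ((N + 1 : ℕ) : ℝ) := by
    rw [Nat.card_Icc]
    exact_mod_cast Nat.sub_le _ _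
  set x : ℝ := ((N + 1 : ℕ) : ℝ)
  calc M.P.real {ω | armHi τ α (Δt / 4) (N + 1) ω ≠ iHi}
      ≤ M.P.real (⋃ n ∈ Finset.Icc ((N + 1) / 16) N,
          {ω | ¬ (stateAfter τ α (Δt / 4) ω n).Accurate M α (n + 1)}) :=
        ENNReal.toReal_mono (measure_ne_top _ _) (measure_mono_ae hsub)
    _ ≤ ∑ n ∈ Finset.Icc ((N + 1) / 16) N, 4 * A * (x * x ^ (-(2 * α))) :=
        (measureReal_biUnion_finset_le _ _).trans (Finset.sum_le_sum hterm)
    _ = (Finset.Icc ((N + 1) / 16) N).card * (4 * A * (x * x ^ (-(2 * α)))) := by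
        rw [Finset.sum_const, nsmul_eq_mul]
    _ ≤ x * (4 * A * (x * x ^ (-(2 * α)))) := by gcongr
    _ = 4 * (A * (x ^ 2 * x ^ (-(2 * α)))) := by ring
    _ = 4 * (A / x ^ (2 * α - 2)) := by
        rw [div_eq_mul_inv, ← Real.rpow_neg hkpos.le, ← Real.rpow_natCast x 2,
          ← Real.rpow_add hkpos]
        congr 3
        push_cast
        ring
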